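/- Let $l^2=l^2(\mathbb Z;\mathbb C)$, let $C_b(\mathbb R;l^2)$ be the space of bounded continuous functions $\mathbb R\to l^2$ with the supremum norm, let $\kappa\in\mathbb R$, $\gamma>0$, and let $F\in C([0,\infty);\mathbb R)$ satisfy $F(0)=0$ and, for some constants $a,b>0$, $$\bigl|F(|x|^2)x-F(|y|^2)y\bigr|\le a\,(|x|^b+|y|^b)\,|x-y|\qquad\text{for all }x,y\in\mathbb C .$$ Let $g_0=(g_0^{(1)},g_0^{(2)})\in [C_b(\mathbb R;l^2)]^2$, where $g_0^{(1)}$ and $g_0^{(2)}$ are almost periodic as $l^2$-valued functions (for every $\varepsilon>0$ there is $k>0$ such that every interval of length $k$ contains a $\tau$ with $\sup_{t}\|g_0^{(i)}(t+\tau)-g_0^{(i)}(t)\|_{l^2}<\varepsilon$), and suppose that $\gamma-2\sup_{t}\|g_0^{(2)}(t)\|_{l^2}>0$. Let the hull $\mathcal H(g_0)$ be the closure in $[C_b(\mathbb R;l^2)]^2$ of the set of translates $\{g_0(\cdot+h):h\in\mathbb R\}$, and let $T(h)g=g(\cdot+h)$. Then for all $g=(g^{(1)},g^{(2)})\in\mathcal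 H(g_0)$, $t_0\in\mathbb R$ and $\psi_{0}\in l^2$ the problem $$i\dot\psi_n=\kappa(\psi_{n+1}-2\psi_n+\psi_{n-1})-i\gamma\psi_n+F(|\psi_n|^2)\psi_n+g^{(1)}_n(t)+g^{(2)}_n(t)\psi_n\quad(n\in\mathbb Z,\ t>t_0),\qquad \psi(t_0)=\psi_0,$$ has exactly one solution $\psi:[t_0,\infty)\to l^2$ (continuous on $[t_0,\infty)$ and differentiable in $l^2$ for $t>t_0$); put $U^g(t,t_0)\psi_0=\psi(t)$ for $t\ge t_0$. The maps $S(t)(\psi,g)=(U^g(t,0)\psi,\,T(t)g)$, $t\ge0$, form a semigroup on $l^2\times\mathcal H(g_0)$, and this semigroup has a global attractor $\mathcal A_S$, that is, a compact set with $S(t)\mathcal A_S=\mathcal A_S$ for all $t\ge0$ that attracts every bounded set. The family of processes $\{U^g(t,t_0)\}_{g\in\mathcal H(g_0)}$ has a compact uniform attractor $\mathcal A\subset l^2$, that is, a compact set such that $$\lim_{t\to\infty}\ \sup_{g\in\mathcal H(g_0)}\ \sup_{\psi\in B}\ \inf_{v\in\mathcal A}\|U^g(t,t_0)\psi-v\|_{l^2}=0\qquad\text{for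 every }t_0\in\mathbb R\text{ and every bounded }B\subset l^2,$$ and such that $\mathcal A$ is contained in every closed set with this property. Moreover, $\mathcal A$ is the projection of $\mathcal A_S$ onto $l^2$, and $$\mathcal A=\bigcup_{g\in\mathcal H(g_0)}\mathcal K_g(0),$$ where $\mathcal K_g(0)$ is the set of the values $\psi(0)$ of all $\psi\in C_b(\mathbb R;l^2)$ with $U^g(t,t_0)\psi(t_0)=\psi(t)$ for all $t_0\in\mathbb R$ and $t\ge t_0$. -/

import Mathlib

open Filter Topology

noncomputable section

namespace DNLS

/-- The Hilbert space `l²` of square-summable complex sequences indexed by `ℤ`. -/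
abbrev l2 : Type := lp (fun _ : ℤ => ℂ) 2

/-- The Banach space `C_b(ℝ; l²)` of bounded continuous functions with the supremum norm. -/
abbrev Cb : Type := BoundedContinuousFunction ℝ l2

/-- Bohr almost periodicity of a function of a real variable: it is continuous, and for every
`ε > 0` there is a length `k` such that every interval of length `k` contains an
`ε`-almost period. -/
def AlmostPeriodic {X : Type*} [MetricSpace X] (f : ℝ → X) : Prop :=
  Continuous f ∧ ∀ ε : ℝ, 0 < ε → ∃ k : ℝ, 0 < k ∧ ∀ x : ℝ,
    ∃ τ ∈ Set.Icc x (x + k), ∀ t : ℝ, dist (f (t + τ)) (f t) < ε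

/-- The translation `f ↦ f (· + h)` on `C_b(ℝ; l²)`. -/
def shift (h : ℝ) (f : Cb) : Cb :=
  f.compContinuous (ContinuousMap.addRight h)

/-- The translation `T(h)` on pairs of driving terms. -/
def translate (h : ℝ) (g : Cb × Cb) : Cb × Cb :=
  (shift h g.1, shift h g.2)

/-- The hull `H(g₀)`: the closure of the set of all translates of `g₀`. -/
def hull (g₀ : Cb × Cb) : Set (Cb × Cb) :=
  closure (Set.range fun h : ℝ => translate h g₀)

theorem shift_apply (h : ℝ) (f : Cb) (t : ℝ) : shift h f t = f (t + h) := rfl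

theorem continuous_translate (h : ℝ) : Continuous (translate h) := by
  have hs : Continuous (shift h) :=
    BoundedContinuousFunction.continuous_compContinuous (ContinuousMap.addRight h)
  exact (hs.comp continuous_fst).prodMk (hs.comp continuous_snd)

theorem translate_translate (h s : ℝ) (g : Cb × Cb) :
    translate h (translate s g) = translate (h + s) g := by
  refine Prod.ext ?_ ?_ <;> refine BoundedContinuousFunction.ext fun t => ?_ <;>
    simp only [translate, shift_apply, add_assoc]

theorem translate_mem_hull (h : ℝ) {g₀ g : Cb × Cb} (hg : g ∈ hull g₀) :
    translate h g ∈ hull g₀ := by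
  refine map_mem_closure (continuous_translate h) hg ?_
  rintro _ ⟨s, rfl⟩
  exact ⟨h + s, (translate_translate h s g₀).symm⟩

/-- `ψ` solves on `[t₀, ∞)` the initial value problem
`i ψₙ' = κ (ψₙ₊₁ - 2 ψₙ + ψₙ₋₁) - i γ ψₙ + F(|ψₙ|²) ψₙ + gₙ⁽¹⁾(t) + gₙ⁽²⁾(t) ψₙ`, `ψ(t₀) = ψ₀`,
the time derivative `v` being taken in `l²`. Only the values on `[t₀, ∞)` matter. -/
def IsSolution (κ γ : ℝ) (F : ℝ → ℝ) (g : Cb × Cb) (t₀ : ℝ) (ψ₀ : l2) (ψ : ℝ → l2) : Prop :=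
  ψ t₀ = ψ₀ ∧ ContinuousOn ψ (Set.Ici t₀) ∧
    ∀ t : ℝ, t₀ < t → ∃ v : l2, HasDerivAt ψ v t ∧ ∀ n : ℤ,
      Complex.I * v n =
        (κ : ℂ) * (ψ t (n + 1) - 2 * ψ t n + ψ t (n - 1)) - Complex.I * (γ : ℂ) * ψ t n
          + (F (‖ψ t n‖ ^ 2) : ℂ) * ψ t n + g.1 t n + g.2 t n * ψ t n

/-- The process `U^g(t, t₀)`: it sends `ψ₀` to the state at time `t ≥ t₀` of the solution
which starts from `ψ₀` at time `t₀`. -/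
def process (κ γ : ℝ) (F : ℝ → ℝ) (g : Cb × Cb) (t t₀ : ℝ) (ψ₀ : l2) : l2 :=
  Classical.epsilon (fun ψ : ℝ → l2 => IsSolution κ γ F g t₀ ψ₀ ψ) t

/-- The Hausdorff semidistance `sup_{u ∈ U} inf_{v ∈ V} d(u, v)`, with values in `[0, ∞]`. -/
def semidist {X : Type*} [MetricSpace X] (U V : Set X) : ENNReal :=
  ⨆ u ∈ U, Metric.infEDist u V

/-- `A` attracts every bounded set, uniformly with respect to the symbol `g` in `H`, under the
family of processes `U`. -/
def UniformlyAttracts {X G : Type*} [MetricSpace X] (U : G → ℝ → ℝ → X → X) (H : Set G)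
    (A : Set X) : Prop :=
  ∀ (t₀ : ℝ) (B : Set X), Bornology.IsBounded B →
    Tendsto (fun t : ℝ => ⨆ g ∈ H, semidist (U g t t₀ '' B) A) atTop (𝓝 0)

/-- `A` is a uniform (with respect to `g ∈ H`) attractor of the family of processes `U`: the
minimal closed set that attracts every bounded set uniformly in `g ∈ H`. -/
def IsUniformAttractor {X G : Type*} [MetricSpace X] (U : G → ℝ → ℝ → X → X) (H : Set G)
    (A : Set X) : Prop :=
  IsClosed A ∧ UniformlyAttracts U H A ∧
    ∀ A' : Set X, IsClosed A' → UniformlyAttracts U H A' → A ⊆ A'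

/-- `A` is a global attractor of `S(t)`, `t ≥ 0`: it is compact, invariant, and attracts every
bounded set. -/
def IsGlobalAttractor {X : Type*} [MetricSpace X] (S : ℝ → X → X) (A : Set X) : Prop :=
  IsCompact A ∧ (∀ t : ℝ, 0 ≤ t → S t '' A = A) ∧
    ∀ B : Set X, Bornology.IsBounded B →
      Tendsto (fun t : ℝ => semidist (S t '' B) A) atTop (𝓝 0)

/-- The skew-product semigroup `S(t)(ψ, g) = (U^g(t, 0) ψ, T(t) g)` on `l² × H(g₀)`. -/
def skewProduct (κ γ : ℝ) (F : ℝ → ℝ) (g₀ : Cb × Cb) (t : ℝ) (p : l2 × hull g₀) :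
    l2 × hull g₀ :=
  (process κ γ F p.2 t 0 p.1, ⟨translate t p.2, translate_mem_hull t p.2.2⟩)

/-- The kernel `𝒦_g` of the process `U^g`: the set of its bounded complete solutions. -/
def kernel (κ γ : ℝ) (F : ℝ → ℝ) (g : Cb × Cb) : Set Cb :=
  {ψ | ∀ t₀ t : ℝ, t₀ ≤ t → process κ γ F g t t₀ (ψ t₀) = ψ t}

/-- The kernel section `𝒦_g(τ)`. -/
def kernelSection (κ γ : ℝ) (F : ℝ → ℝ) (g : Cb × Cb) (τ : ℝ) : Set l2 :=
  {x | ∃ ψ ∈ kernel κ γ F g, ψ τ = x}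

end DNLS

end

namespace DNLS

/-! Letting time shifts act on the symbol turns the nonautonomous family into one autonomous
semigroup on `l² × hull g₀`; its global attractor is then projected.

Everything rests on a weighted energy estimate (`inner_diag_field_le`). In the real inner product
`-i` is skew, so the Laplacian does no work and the nonlinearity, a real multiple of `-i ψₙ` at each
site, does none either. Since `γ - ‖g⁽²⁾‖ > 0`, the damping wins: solutions are global and a ball
absorbs uniformly over the hull. With a slowly varying weight vanishing at the origin, the Laplacian
leaves only a commutator of size `O(1/k)`. The forcing has uniformly small tails because the hull is
compact by almost periodicity. So the tails of solutions become uniformly small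
(`norm_sq_tail_process_le`), which replaces the compactness that `l²` lacks.

The skew product is thus continuous, dissipative and asymptotically compact, and the `ω`-limit set
of an absorbing set is its attractor. The projection attracts uniformly because the whole hull is
bounded. Invariance puts each of its points in the image of one bounded set at every time, which
gives minimality. Bounded complete trajectories give the kernel sections. -/

/-! ### Operators on `l²` -/

theorem memlp_of_apply_le {f : ℤ → ℂ} (y : l2) (C : ℝ) (h : ∀ n, ‖f n‖ ≤ C * ‖y n‖) :
    Memℓp f 2 := by
  refine Memℓp.mono ((lp.memℓp (C • y)).norm) fun n => ?_
  rw [lp.coeFn_smul, Pi.smul_apply, norm_smul]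
  exact (h n).trans (mul_le_mul_of_nonneg_right (le_abs_self C) (norm_nonneg _))

theorem norm_le_of_apply_le {x y : l2} {C : ℝ} (hC : 0 ≤ C) (h : ∀ n, ‖x n‖ ≤ C * ‖y n‖) :
    ‖x‖ ≤ C * ‖y‖ := by
  have : ‖C • y‖ = C * ‖y‖ := by rw [norm_smul, Real.norm_of_nonneg hC]
  rw [← this]
  refine lp.norm_mono (by norm_num) fun n => ?_
  rw [lp.coeFn_smul, Pi.smul_apply, norm_smul, Real.norm_of_nonneg hC]
  exact h n

theorem norm_apply_le (x : l2) (n : ℤ) : ‖x n‖ ≤ ‖x‖ :=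
  lp.norm_apply_le_norm (by norm_num) x n

theorem add_apply (x y : l2) (n : ℤ) : (x + y) n = x n + y n := rfl

theorem sub_apply (x y : l2) (n : ℤ) : (x - y) n = x n - y n := rfl

theorem smul_apply (c : ℂ) (x : l2) (n : ℤ) : (c • x) n = c * x n := rfl

theorem real_smul_apply (c : ℝ) (x : l2) (n : ℤ) : (c • x) n = c * x n := rfl

theorem inner_eq_zero_of_apply {x y : l2} (h : ∀ n, inner ℝ (x n) (y n) = 0) :
    inner ℝ x y = 0 := by
  rw [lp.inner_eq_tsum]
  simp [h]

theorem inner_eq_of_apply {x y z w : l2} (h : ∀ n, inner ℝ (x n) (y n) = inner ℝ (z n) (w n)) :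
    inner ℝ x y = inner ℝ z w := by
  simp only [lp.inner_eq_tsum, h]

/-- The lattice translation `(xₙ) ↦ (xₙ₊ₘ)` on `l²`. -/
noncomputable def latticeShift (m : ℤ) : l2 →L[ℝ] l2 :=
  LinearMap.mkContinuous
    { toFun := fun x => ⟨fun n => x (n + m), by
        have := (lp.memℓp x).summable (by norm_num)
        exact memℓp_gen (this.comp_injective (add_left_injective m))⟩
      map_add' := fun _ _ => rfl
      map_smul' := fun _ _ => rfl } 1 (by
    intro x
    rw [one_mul]
    refine lp.norm_le_of_tsum_le (by norm_num) (norm_nonneg x) (le_of_eq ?_)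
    rw [lp.norm_rpow_eq_tsum (by norm_num)]
    exact (Equiv.addRight m).tsum_eq (fun n => ‖x n‖ ^ (2 : ENNReal).toReal))

@[simp] theorem latticeShift_apply (m : ℤ) (x : l2) (n : ℤ) : latticeShift m x n = x (n + m) := rfl

theorem norm_latticeShift_le (m : ℤ) (x : l2) : ‖latticeShift m x‖ ≤ ‖x‖ := by
  have := (latticeShift m).le_of_opNorm_le (LinearMap.mkContinuous_norm_le _ zero_le_one _) x
  rwa [one_mul] at this

theorem inner_latticeShift_neg (x y : l2) (m : ℤ) :
    inner ℝ x (latticeShift (-m) y) = inner ℝ (latticeShift m x) y := by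
  simp only [lp.inner_eq_tsum, latticeShift_apply]
  rw [← (Equiv.addRight m).tsum_eq]
  simp

/-- Multiplication by a real sequence with values in `[-1, 1]`, as an operator on `l²`. -/
noncomputable def diag (w : ℤ → ℝ) (hw : ∀ n, |w n| ≤ 1) : l2 →L[ℝ] l2 :=
  LinearMap.mkContinuous
    { toFun := fun x => ⟨fun n => (w n : ℂ) * x n, memlp_of_apply_le x 1 fun n => by
        rw [norm_mul, Complex.norm_real]
        exact mul_le_mul_of_nonneg_right (hw n) (norm_nonneg _)⟩
      map_add' := fun x y => lp.ext <| funext fun n => mul_add (w n : ℂ) (x n) (y n)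
      map_smul' := fun c x => lp.ext <| funext fun n => mul_smul_comm c (w n : ℂ) (x n) } 1 (by
    intro x
    refine norm_le_of_apply_le zero_le_one fun n => ?_
    change ‖(w n : ℂ) * x n‖ ≤ _
    rw [norm_mul, Complex.norm_real]
    exact mul_le_mul_of_nonneg_right (hw n) (norm_nonneg _))

@[simp] theorem diag_apply (w : ℤ → ℝ) (hw : ∀ n, |w n| ≤ 1) (x : l2) (n : ℤ) :
    diag w hw x n = (w n : ℂ) * x n := rfl

theorem norm_diag_le (w : ℤ → ℝ) (hw : ∀ n, |w n| ≤ 1) (x : l2) : ‖diag w hw x‖ ≤ ‖x‖ := by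
  have := (diag w hw).le_of_opNorm_le (LinearMap.mkContinuous_norm_le _ zero_le_one _) x
  rwa [one_mul] at this

theorem inner_diag (w : ℤ → ℝ) (hw : ∀ n, |w n| ≤ 1) (x y : l2) :
    inner ℝ (diag w hw x) y = inner ℝ x (diag w hw y) := by
  refine inner_eq_of_apply fun n => ?_
  simp only [diag_apply, ← Complex.real_smul, real_inner_smul_left, real_inner_smul_right]

theorem diag_one (h : ∀ _ : ℤ, |(1 : ℝ)| ≤ 1) (x : l2) : diag (fun _ => 1) h x = x :=
  lp.ext <| funext fun n => by simp

/-- The pointwise product of two sequences in `l²`. -/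
noncomputable def mulSeq (u x : l2) : l2 :=
  ⟨fun n => u n * x n, memlp_of_apply_le x ‖u‖ fun n => by
    rw [norm_mul]
    exact mul_le_mul_of_nonneg_right (norm_apply_le u n) (norm_nonneg _)⟩

@[simp] theorem mulSeq_apply (u x : l2) (n : ℤ) : mulSeq u x n = u n * x n := rfl

theorem norm_mulSeq_le (u x : l2) : ‖mulSeq u x‖ ≤ ‖u‖ * ‖x‖ :=
  norm_le_of_apply_le (norm_nonneg u) fun n => by
    rw [mulSeq_apply, norm_mul]
    exact mul_le_mul_of_nonneg_right (norm_apply_le u n) (norm_nonneg _)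

theorem mulSeq_sub (u x y : l2) : mulSeq u (x - y) = mulSeq u x - mulSeq u y :=
  lp.ext <| funext fun n => mul_sub (u n) (x n) (y n)

theorem sub_mulSeq (u v x : l2) : mulSeq (u - v) x = mulSeq u x - mulSeq v x :=
  lp.ext <| funext fun n => sub_mul (u n) (v n) (x n)

/-! ### The nonlinearity and the vector field -/

open Classical in
/-- The superposition operator `(xₙ) ↦ (F(|xₙ|²) xₙ)` on `l²`. -/
noncomputable def superposition (F : ℝ → ℝ) (x : l2) : l2 :=
  if h : Memℓp (fun n => (F (‖x n‖ ^ 2) : ℂ) * x n) 2 then ⟨_, h⟩ else 0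

/-- The local Lipschitz condition on `z ↦ F(|z|²) z`. -/
def PowerLipschitz (a b : ℝ) (F : ℝ → ℝ) : Prop :=
  0 < a ∧ 0 < b ∧ ∀ x y : ℂ, ‖(F (‖x‖ ^ 2) : ℂ) * x - (F (‖y‖ ^ 2) : ℂ) * y‖
    ≤ a * (‖x‖ ^ b + ‖y‖ ^ b) * ‖x - y‖

variable {a b : ℝ} {F : ℝ → ℝ}

/-- Comparison with `y = 0` in the Lipschitz condition bounds the factor at each site by `a ‖x‖ ^
b`, so the default value `0` is never taken. -/
theorem superposition_apply (hF : PowerLipschitz a b F) (x : l2)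
    (n : ℤ) : superposition F x n = (F (‖x n‖ ^ 2) : ℂ) * x n := by
  obtain ⟨ha, hb, hLip⟩ := hF
  have h : Memℓp (fun n => (F (‖x n‖ ^ 2) : ℂ) * x n) 2 := by
    refine memlp_of_apply_le x (a * ‖x‖ ^ b) fun n => ?_
    have h := hLip (x n) 0
    simp only [norm_zero, mul_zero, sub_zero, Real.zero_rpow hb.ne', add_zero] at h
    refine h.trans (mul_le_mul_of_nonneg_right ?_ (norm_nonneg _))
    have := norm_apply_le x n
    gcongr
  rw [superposition, dif_pos h]

theorem norm_superposition_sub_le (hF : PowerLipschitz a b F)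
    {R : ℝ} (hR : 0 ≤ R) {x y : l2} (hx : ‖x‖ ≤ R) (hy : ‖y‖ ≤ R) :
    ‖superposition F x - superposition F y‖ ≤ 2 * a * R ^ b * ‖x - y‖ := by
  have ⟨ha, hb, hLip⟩ := hF
  refine norm_le_of_apply_le (by positivity) fun n => ?_
  simp only [lp.coeFn_sub, Pi.sub_apply, superposition_apply hF]
  refine (hLip _ _).trans (mul_le_mul_of_nonneg_right ?_ (norm_nonneg _))
  have h1 : ‖x n‖ ^ b ≤ R ^ b := by
    have := (norm_apply_le x n).trans hx
    gcongr
  have h2 : ‖y n‖ ^ b ≤ R ^ b := by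
    have := (norm_apply_le y n).trans hy
    gcongr
  calc a * (‖x n‖ ^ b + ‖y n‖ ^ b) ≤ a * (R ^ b + R ^ b) := by gcongr
    _ = 2 * a * R ^ b := by ring

/-- The Laplacian of the lattice `ℤ`. -/
noncomputable def laplacian (x : l2) : l2 := latticeShift 1 x - 2 • x + latticeShift (-1) x

theorem laplacian_sub (x y : l2) : laplacian (x - y) = laplacian x - laplacian y := by
  simp only [laplacian, map_sub, smul_sub]
  abel

theorem norm_laplacian_le (x : l2) : ‖laplacian x‖ ≤ 4 * ‖x‖ := by
  have h1 := norm_latticeShift_le 1 x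
  have h2 := norm_latticeShift_le (-1) x
  have h3 : ‖2 • x‖ ≤ 2 * ‖x‖ := by rw [two_smul, two_mul]; exact norm_add_le x x
  have h4 := norm_add_le (latticeShift 1 x - 2 • x) (latticeShift (-1) x)
  have h5 := norm_sub_le (latticeShift 1 x) (2 • x)
  unfold laplacian
  linarith

/-- The vector field of the lattice equation solved for the time derivative. -/
noncomputable def field (κ γ : ℝ) (F : ℝ → ℝ) (g : Cb × Cb) (t : ℝ) (x : l2) : l2 :=
  (-Complex.I) • (κ • laplacian x + superposition F x + g.1 t + mulSeq (g.2 t) x) - γ • x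

theorem eq_field_iff (hF : PowerLipschitz a b F) {κ γ : ℝ}
    {g : Cb × Cb} {t : ℝ} {x v : l2} :
    (∀ n : ℤ, Complex.I * v n =
        (κ : ℂ) * (x (n + 1) - 2 * x n + x (n - 1)) - Complex.I * (γ : ℂ) * x n
          + (F (‖x n‖ ^ 2) : ℂ) * x n + g.1 t n + g.2 t n * x n) ↔ v = field κ γ F g t x := by
  have hf : ∀ n, field κ γ F g t x n =
      -Complex.I * ((κ : ℂ) * (x (n + 1) - 2 * x n + x (n - 1))
          + (F (‖x n‖ ^ 2) : ℂ) * x n + g.1 t n + g.2 t n * x n) - (γ : ℂ) * x n := fun n => by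
    rw [← superposition_apply hF]
    simp only [field, laplacian, sub_apply, add_apply, smul_apply, real_smul_apply, two_smul,
      latticeShift_apply, mulSeq_apply, ← sub_eq_add_neg]
    ring
  constructor
  · intro h
    refine lp.ext <| funext fun n => ?_
    rw [hf]
    linear_combination (-Complex.I) * h n + (v n + (γ : ℂ) * x n) * Complex.I_sq
  · rintro rfl n
    rw [hf]
    linear_combination (-((κ : ℂ) * (x (n + 1) - 2 * x n + x (n - 1))
          + (F (‖x n‖ ^ 2) : ℂ) * x n + g.1 t n + g.2 t n * x n)) * Complex.I_sq

theorem norm_neg_I_smul (x : l2) : ‖(-Complex.I) • x‖ = ‖x‖ := by simp [norm_smul]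

/-- Two symbols are compared at once, so that one estimate serves existence, uniqueness and
continuity in the symbol. Only `‖g.2‖` enters the Lipschitz constant, which stays fixed while `h`
varies. -/
theorem norm_field_sub_le (hF : PowerLipschitz a b F) (κ γ : ℝ)
    (g h : Cb × Cb) (t : ℝ) {R : ℝ} (hR : 0 ≤ R) {x y : l2} (hx : ‖x‖ ≤ R) (hy : ‖y‖ ≤ R) :
    ‖field κ γ F g t x - field κ γ F h t y‖ ≤
      (4 * |κ| + |γ| + 2 * a * R ^ b + ‖g.2‖) * ‖x - y‖ + (1 + R) * ‖g - h‖ := by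
  have e : field κ γ F g t x - field κ γ F h t y =
      (-Complex.I) • (κ • laplacian (x - y) + (superposition F x - superposition F y)
        + (g.1 - h.1) t + (mulSeq (g.2 t) (x - y) + mulSeq ((g.2 - h.2) t) y)) - γ • (x - y) := by
    simp only [field, laplacian_sub, mulSeq_sub, sub_mulSeq, BoundedContinuousFunction.sub_apply,
      smul_sub, smul_add]
    abel
  have h1 : ‖κ • laplacian (x - y)‖ ≤ |κ| * (4 * ‖x - y‖) := by
    rw [norm_smul, Real.norm_eq_abs]
    exact mul_le_mul_of_nonneg_left (norm_laplacian_le _) (abs_nonneg _)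
  have h2 := norm_superposition_sub_le hF hR hx hy
  have h3 : ‖(g.1 - h.1) t‖ ≤ ‖g - h‖ :=
    ((g.1 - h.1).norm_coe_le_norm t).trans (norm_fst_le (g - h))
  have h4 : ‖mulSeq (g.2 t) (x - y)‖ ≤ ‖g.2‖ * ‖x - y‖ :=
    (norm_mulSeq_le _ _).trans
      (mul_le_mul_of_nonneg_right (g.2.norm_coe_le_norm t) (norm_nonneg _))
  have h5 : ‖mulSeq ((g.2 - h.2) t) y‖ ≤ ‖g - h‖ * R :=
    (norm_mulSeq_le _ _).trans (mul_le_mul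
      (((g.2 - h.2).norm_coe_le_norm t).trans (norm_snd_le (g - h))) hy (norm_nonneg _)
      (norm_nonneg _))
  have h6 : ‖γ • (x - y)‖ = |γ| * ‖x - y‖ := by rw [norm_smul, Real.norm_eq_abs]
  rw [e]
  refine (norm_sub_le _ _).trans ?_
  rw [norm_neg_I_smul, h6]
  have h7 := norm_add_le (κ • laplacian (x - y) + (superposition F x - superposition F y)
        + (g.1 - h.1) t) (mulSeq (g.2 t) (x - y) + mulSeq ((g.2 - h.2) t) y)
  have h8 := norm_add_le (κ • laplacian (x - y) + (superposition F x - superposition F y))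
        ((g.1 - h.1) t)
  have h9 := norm_add_le (κ • laplacian (x - y)) (superposition F x - superposition F y)
  have h10 := norm_add_le (mulSeq (g.2 t) (x - y)) (mulSeq ((g.2 - h.2) t) y)
  nlinarith

theorem continuous_field_left (κ γ : ℝ) (F : ℝ → ℝ) (g : Cb × Cb) (x : l2) :
    Continuous fun t => field κ γ F g t x := by
  have hm : Continuous fun t => mulSeq (g.2 t) x := by
    have : LipschitzWith ‖x‖₊ fun u => mulSeq u x :=
      LipschitzWith.of_dist_le_mul fun u v => by
        rw [dist_eq_norm, dist_eq_norm, ← sub_mulSeq, mul_comm]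
        exact norm_mulSeq_le _ _
    exact this.continuous.comp g.2.continuous
  have h1 := g.1.continuous
  unfold field
  fun_prop

/-! ### Weighted energy estimates -/

theorem inner_neg_I_smul (x y : l2) :
    inner ℝ x ((-Complex.I) • y) = -inner ℝ ((-Complex.I) • x) y := by
  rw [← inner_neg_left]
  refine inner_eq_of_apply fun n => ?_
  simp only [lp.coeFn_smul, lp.coeFn_neg, Pi.smul_apply, Pi.neg_apply, smul_eq_mul, Complex.inner]
  simp
  ring

theorem inner_neg_I_smul_self (x : l2) : inner ℝ x ((-Complex.I) • x) = 0 := by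
  have h := inner_neg_I_smul x x
  rw [real_inner_comm] at h
  linarith [real_inner_comm x ((-Complex.I) • x)]

theorem diag_neg_I_smul (w : ℤ → ℝ) (hw : ∀ n, |w n| ≤ 1) (x : l2) :
    diag w hw ((-Complex.I) • x) = (-Complex.I) • diag w hw x :=
  lp.ext <| funext fun n => by simp only [diag_apply, smul_apply]; ring

theorem latticeShift_neg_I_smul (m : ℤ) (x : l2) :
    latticeShift m ((-Complex.I) • x) = (-Complex.I) • latticeShift m x := rfl

theorem diag_mulSeq (w : ℤ → ℝ) (hw : ∀ n, |w n| ≤ 1) (u x : l2) :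
    diag w hw (mulSeq u x) = mulSeq u (diag w hw x) :=
  lp.ext <| funext fun n => by simp; ring

/-- The two shifts are adjoint and `-i` is skew, so only the commutator of the shift with `w²`
survives. Its coefficient `(wₙ - wₙ₊₁)(wₙ + wₙ₊₁)` is at most `2 η` in absolute value. -/
theorem abs_inner_diag_laplacian_le {w : ℤ → ℝ} (hw : ∀ n, |w n| ≤ 1) {η : ℝ}
    (hη : ∀ n, |w (n + 1) - w n| ≤ η) (x : l2) :
    |inner ℝ (diag w hw x) (diag w hw ((-Complex.I) • laplacian x))| ≤ 2 * η * ‖x‖ ^ 2 := by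
  have hη0 : 0 ≤ η := (abs_nonneg _).trans (hη 0)
  set V := diag w hw with hV
  set R := latticeShift 1
  have hL : inner ℝ (V x) (V ((-Complex.I) • latticeShift (-1) x)) =
      -inner ℝ x ((-Complex.I) • R (V (V x))) := by
    rw [hV, ← inner_diag, inner_neg_I_smul, ← latticeShift_neg_I_smul, real_inner_comm]
    have := inner_latticeShift_neg x ((-Complex.I) • V (V x)) (-1)
    rw [neg_neg] at this
    exact congrArg Neg.neg this.symm
  have hR : inner ℝ (V x) (V ((-Complex.I) • R x)) = inner ℝ x ((-Complex.I) • V (V (R x))) := by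
    rw [inner_diag, hV, diag_neg_I_smul, diag_neg_I_smul]
  have e : inner ℝ (V x) (V ((-Complex.I) • laplacian x)) =
      inner ℝ x ((-Complex.I) • (V (V (R x)) - R (V (V x)))) := by
    have h0 : inner ℝ (V x) (V ((-Complex.I) • (2 • x))) = 0 := by
      rw [two_smul, smul_add, map_add, inner_add_right, hV, diag_neg_I_smul,
        inner_neg_I_smul_self, add_zero]
    rw [laplacian, smul_add, smul_sub, map_add, map_sub, inner_add_right, inner_sub_right, h0, hL,
      hR, smul_sub, inner_sub_right]
    ring
  have hc : ‖V (V (R x)) - R (V (V x))‖ ≤ 2 * η * ‖R x‖ := by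
    refine norm_le_of_apply_le (by positivity) fun n => ?_
    have : (V (V (R x)) - R (V (V x))) n =
        (((w n - w (n + 1)) * (w n + w (n + 1)) : ℝ) : ℂ) * R x n := by
      simp [hV, R]
      ring
    rw [this, norm_mul, Complex.norm_real, Real.norm_eq_abs, abs_mul, abs_sub_comm]
    refine mul_le_mul_of_nonneg_right ?_ (norm_nonneg _)
    have h1 := abs_add_le (w n) (w (n + 1))
    have h2 := hw n
    have h3 := hw (n + 1)
    rw [mul_comm 2 η]
    exact mul_le_mul (hη n) (by linarith) (abs_nonneg _) hη0
  rw [e]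
  refine (abs_real_inner_le_norm _ _).trans ?_
  rw [norm_neg_I_smul]
  calc ‖x‖ * ‖V (V (R x)) - R (V (V x))‖ ≤ ‖x‖ * (2 * η * ‖x‖) := by
        gcongr
        exact hc.trans (mul_le_mul_of_nonneg_left (norm_latticeShift_le 1 x) (by positivity))
    _ = 2 * η * ‖x‖ ^ 2 := by ring

/-- The weight commutes with multiplication by `g.2 t`, and the nonlinear term is orthogonal to the
state site by site. Weight `1` gives the global energy bound, `tailWeight` the tail bound. -/
theorem inner_diag_field_le (hF : PowerLipschitz a b F) (κ γ : ℝ)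
    (g : Cb × Cb) (t : ℝ) {w : ℤ → ℝ} (hw : ∀ n, |w n| ≤ 1) {η : ℝ}
    (hη : ∀ n, |w (n + 1) - w n| ≤ η) (x : l2) :
    inner ℝ (diag w hw x) (diag w hw (field κ γ F g t x)) ≤
      -(γ - ‖g.2‖) * ‖diag w hw x‖ ^ 2 + ‖diag w hw (g.1 t)‖ * ‖diag w hw x‖
        + 2 * |κ| * η * ‖x‖ ^ 2 := by
  set V := diag w hw with hV
  have e : V (field κ γ F g t x) = κ • V ((-Complex.I) • laplacian x)
      + V ((-Complex.I) • superposition F x) + (-Complex.I) • V (g.1 t)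
      + (-Complex.I) • mulSeq (g.2 t) (V x) - γ • V x := by
    rw [field, map_sub, map_smul V γ, smul_add, smul_add, smul_add, map_add, map_add, map_add,
      smul_comm (-Complex.I) κ, map_smul V κ, hV, diag_neg_I_smul _ _ (mulSeq _ _), diag_mulSeq,
      diag_neg_I_smul _ _ (g.1 t)]
  have h1 : κ * inner ℝ (V x) (V ((-Complex.I) • laplacian x)) ≤ 2 * |κ| * η * ‖x‖ ^ 2 := by
    refine (le_abs_self _).trans ?_
    rw [abs_mul]
    calc _ ≤ |κ| * (2 * η * ‖x‖ ^ 2) :=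
          mul_le_mul_of_nonneg_left (abs_inner_diag_laplacian_le hw hη x) (abs_nonneg _)
      _ = _ := by ring
  have h2 : inner ℝ (V x) (V ((-Complex.I) • superposition F x)) = 0 := by
    refine inner_eq_zero_of_apply fun n => ?_
    simp [hV, superposition_apply hF, Complex.inner]
    ring
  have h3 : inner ℝ (V x) ((-Complex.I) • V (g.1 t)) ≤ ‖V (g.1 t)‖ * ‖V x‖ := by
    refine (real_inner_le_norm _ _).trans ?_
    rw [norm_neg_I_smul, mul_comm]
  have h4 : inner ℝ (V x) ((-Complex.I) • mulSeq (g.2 t) (V x)) ≤ ‖g.2‖ * ‖V x‖ ^ 2 := by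
    refine (real_inner_le_norm _ _).trans ?_
    rw [norm_neg_I_smul]
    have := (norm_mulSeq_le (g.2 t) (V x)).trans
      (mul_le_mul_of_nonneg_right (g.2.norm_coe_le_norm t) (norm_nonneg _))
    nlinarith [norm_nonneg (V x)]
  rw [e, inner_sub_right, inner_add_right, inner_add_right, inner_add_right,
    real_inner_smul_right, real_inner_smul_right, h2, real_inner_self_eq_norm_sq]
  nlinarith

theorem inner_field_le (hF : PowerLipschitz a b F) (κ γ : ℝ)
    (g : Cb × Cb) (t : ℝ) (x : l2) :
    inner ℝ x (field κ γ F g t x) ≤ -(γ - ‖g.2‖) * ‖x‖ ^ 2 + ‖g.1‖ * ‖x‖ := by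
  have h := inner_diag_field_le hF κ γ g t (w := fun _ => 1) (fun _ => by simp) (η := 0)
    (fun _ => by simp) x
  simp only [diag_one] at h
  have := mul_le_mul_of_nonneg_right (g.1.norm_coe_le_norm t) (norm_nonneg x)
  linarith


/-! ### Uniqueness and continuous dependence -/

variable {κ γ : ℝ}

theorem isSolution_iff (hF : PowerLipschitz a b F) {g : Cb × Cb} {t₀ : ℝ} {ψ₀ : l2}
    {ψ : ℝ → l2} : IsSolution κ γ F g t₀ ψ₀ ψ ↔ ψ t₀ = ψ₀ ∧ ContinuousOn ψ (Set.Ici t₀) ∧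
      ∀ t, t₀ < t → HasDerivAt ψ (field κ γ F g t (ψ t)) t := by
  simp only [IsSolution, eq_field_iff hF, exists_eq_right]

/-- The Lipschitz constant of the vector field on the ball of radius `R`. -/
noncomputable def lipConst (κ γ a b : ℝ) (g : Cb × Cb) (R : ℝ) : ℝ :=
  4 * |κ| + |γ| + 2 * a * R ^ b + ‖g.2‖

theorem lipConst_nonneg (hF : PowerLipschitz a b F) (g : Cb × Cb) {R : ℝ} (hR : 0 ≤ R) :
    0 ≤ lipConst κ γ a b g R := by
  have := hF.1
  unfold lipConst
  positivity

theorem norm_field_sub_field_le (hF : PowerLipschitz a b F) (g : Cb × Cb) (t : ℝ)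
    {R : ℝ} (hR : 0 ≤ R) {x y : l2} (hx : ‖x‖ ≤ R) (hy : ‖y‖ ≤ R) :
    ‖field κ γ F g t x - field κ γ F g t y‖ ≤ lipConst κ γ a b g R * ‖x - y‖ := by
  have := norm_field_sub_le hF κ γ g g t hR hx hy
  rwa [sub_self, norm_zero, mul_zero, add_zero] at this

/-- Comparison with the zero symbol at the zero state, where the field vanishes. -/
theorem norm_field_le (hF : PowerLipschitz a b F) (g : Cb × Cb) (t : ℝ)
    {R : ℝ} (hR : 0 ≤ R) {x : l2} (hx : ‖x‖ ≤ R) :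
    ‖field κ γ F g t x‖ ≤ lipConst κ γ a b g R * R + (1 + R) * ‖g‖ := by
  have h := norm_field_sub_le hF κ γ g 0 t hR hx (y := 0) (by simpa using hR)
  have h0 : field κ γ F 0 t 0 = 0 := by
    refine lp.ext <| funext fun n => ?_
    simp only [field, laplacian, sub_apply, add_apply, smul_apply, real_smul_apply, two_smul,
      latticeShift_apply, mulSeq_apply, superposition_apply hF]
    simp
  rw [h0, sub_zero, sub_zero, sub_zero] at h
  exact h.trans (add_le_add_left (mul_le_mul_of_nonneg_left hx (lipConst_nonneg hF g hR)) _)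

theorem continuousOn_field_comp (hF : PowerLipschitz a b F) (g : Cb × Cb) {ψ : ℝ → l2}
    {s : Set ℝ} (hψ : ContinuousOn ψ s) : ContinuousOn (fun t => field κ γ F g t (ψ t)) s := by
  intro t ht
  have h1 : Tendsto (fun u => field κ γ F g u (ψ t)) (𝓝[s] t) (𝓝 (field κ γ F g t (ψ t))) :=
    (continuous_field_left κ γ F g (ψ t)).continuousAt.mono_left nhdsWithin_le_nhds
  refine tendsto_of_tendsto_of_dist h1 ?_
  have h2 : Tendsto (fun u => lipConst κ γ a b g (‖ψ t‖ + 1) * ‖ψ t - ψ u‖) (𝓝[s] t) (𝓝 0) := by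
    have : Tendsto (fun u => ‖ψ t - ψ u‖) (𝓝[s] t) (𝓝 0) := by
      have := ((tendsto_const_nhds (x := ψ t)).sub (hψ t ht)).norm
      rwa [sub_self, norm_zero] at this
    simpa using this.const_mul (lipConst κ γ a b g (‖ψ t‖ + 1))
  have h3 : ∀ᶠ u in 𝓝[s] t, ‖ψ u‖ < ‖ψ t‖ + 1 :=
    (hψ t ht).norm.eventually_lt_const (lt_add_one _)
  refine squeeze_zero' (Eventually.of_forall fun _ => dist_nonneg) ?_ h2
  filter_upwards [h3] with u hu
  rw [dist_eq_norm]
  exact norm_field_sub_field_le hF g u (by positivity) (by linarith) hu.le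

/-- `ψ` solves the lattice equation on `[t₀, t₁]`, with one-sided time derivatives. -/
def SolvesOn (κ γ : ℝ) (F : ℝ → ℝ) (g : Cb × Cb) (t₀ t₁ : ℝ) (ψ : ℝ → l2) : Prop :=
  ContinuousOn ψ (Set.Icc t₀ t₁) ∧
    ∀ t ∈ Set.Ico t₀ t₁, HasDerivWithinAt ψ (field κ γ F g t (ψ t)) (Set.Ici t) t

theorem SolvesOn.mono {g : Cb × Cb} {t₀ t₁ t₂ : ℝ} {ψ : ℝ → l2}
    (h : SolvesOn κ γ F g t₀ t₂ ψ) (ht : t₁ ≤ t₂) : SolvesOn κ γ F g t₀ t₁ ψ :=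
  ⟨h.1.mono (Set.Icc_subset_Icc_right ht), fun t hm => h.2 t (Set.Ico_subset_Ico_right ht hm)⟩

/-- At `t₀` only continuity is given; the right derivative there is the limit of the derivatives at
later times. -/
theorem IsSolution.solvesOn (hF : PowerLipschitz a b F) {g : Cb × Cb} {t₀ : ℝ} {ψ₀ : l2}
    {ψ : ℝ → l2} (h : IsSolution κ γ F g t₀ ψ₀ ψ) (t₁ : ℝ) : SolvesOn κ γ F g t₀ t₁ ψ := by
  obtain ⟨-, hc, hd⟩ := (isSolution_iff hF).1 h
  refine ⟨hc.mono Set.Icc_subset_Ici_self, fun t ht => ?_⟩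
  rcases ht.1.eq_or_lt with rfl | hlt
  · refine hasDerivWithinAt_Ici_of_tendsto_deriv (s := Set.Ioi t₀)
      (fun u hu => (hd u hu).differentiableAt.differentiableWithinAt)
      ((hc t₀ Set.self_mem_Ici).mono Set.Ioi_subset_Ici_self) self_mem_nhdsWithin ?_
    have h1 := (continuousOn_field_comp (κ := κ) (γ := γ) hF g hc t₀ Set.self_mem_Ici).mono
      Set.Ioi_subset_Ici_self
    refine Tendsto.congr' ?_ h1
    filter_upwards [self_mem_nhdsWithin] with u hu
    exact (hd u hu).deriv.symm
  · exact (hd t hlt).hasDerivWithinAt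

theorem norm_sub_le_of_solvesOn (hF : PowerLipschitz a b F) {g h : Cb × Cb} {t₀ t₁ : ℝ}
    {φ ψ : ℝ → l2} (hφ : SolvesOn κ γ F g t₀ t₁ φ) (hψ : SolvesOn κ γ F h t₀ t₁ ψ) {R : ℝ}
    (hφR : ∀ t ∈ Set.Icc t₀ t₁, ‖φ t‖ ≤ R) (hψR : ∀ t ∈ Set.Icc t₀ t₁, ‖ψ t‖ ≤ R) :
    ∀ t ∈ Set.Icc t₀ t₁, ‖φ t - ψ t‖ ≤
      gronwallBound ‖φ t₀ - ψ t₀‖ (lipConst κ γ a b g R) ((1 + R) * ‖g - h‖) (t - t₀) := by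
  refine norm_le_gronwallBound_of_norm_deriv_right_le (f := fun t => φ t - ψ t)
    (hφ.1.sub hψ.1) (fun t ht => (hφ.2 t ht).sub (hψ.2 t ht)) le_rfl fun t ht => ?_
  have ht' := Set.Ico_subset_Icc_self ht
  exact norm_field_sub_le hF κ γ g h t ((norm_nonneg _).trans (hφR t ht')) (hφR t ht') (hψR t ht')

theorem SolvesOn.eqOn (hF : PowerLipschitz a b F) {g : Cb × Cb} {t₀ t₁ : ℝ}
    {φ ψ : ℝ → l2} (hφ : SolvesOn κ γ F g t₀ t₁ φ) (hψ : SolvesOn κ γ F g t₀ t₁ ψ)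
    (h0 : φ t₀ = ψ t₀) : Set.EqOn φ ψ (Set.Icc t₀ t₁) := by
  obtain ⟨R₁, h₁⟩ := isCompact_Icc.exists_bound_of_continuousOn hφ.1
  obtain ⟨R₂, h₂⟩ := isCompact_Icc.exists_bound_of_continuousOn hψ.1
  intro t ht
  have := norm_sub_le_of_solvesOn hF hφ hψ (R := max R₁ R₂)
    (fun t ht => (h₁ t ht).trans (le_max_left _ _))
    (fun t ht => (h₂ t ht).trans (le_max_right _ _)) t ht
  rw [h0, sub_self, sub_self, norm_zero, norm_zero, mul_zero, gronwallBound_ε0_δ0] at this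
  exact sub_eq_zero.1 (norm_le_zero_iff.1 this)

/-! ### Global existence by truncation -/

section Retraction

variable {E : Type*} [NormedAddCommGroup E] [NormedSpace ℝ E]

/-- The radial retraction of a normed space onto the closed ball of radius `R`. -/
noncomputable def radialRetraction (R : ℝ) (x : E) : E := (R / max R ‖x‖) • x

theorem norm_radialRetraction_le {R : ℝ} (hR : 0 < R) (x : E) : ‖radialRetraction R x‖ ≤ R := by
  have hm : 0 < max R ‖x‖ := lt_max_of_lt_left hR
  rw [radialRetraction, norm_smul, Real.norm_of_nonneg (by positivity), div_mul_eq_mul_div,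
    div_le_iff₀ hm]
  exact mul_le_mul_of_nonneg_left (le_max_right _ _) hR.le

theorem radialRetraction_of_norm_le {R : ℝ} (hR : 0 < R) {x : E} (hx : ‖x‖ ≤ R) :
    radialRetraction R x = x := by
  rw [radialRetraction, max_eq_left hx, div_self hR.ne', one_smul]

theorem norm_radialRetraction_sub_le {R : ℝ} (hR : 0 < R) (x y : E) :
    ‖radialRetraction R x - radialRetraction R y‖ ≤ 2 * ‖x - y‖ := by
  have hx : 0 < max R ‖x‖ := lt_max_of_lt_left hR
  have hy : 0 < max R ‖y‖ := lt_max_of_lt_left hR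
  have e : radialRetraction R x - radialRetraction R y =
      (R / max R ‖x‖) • (x - y) + (R / max R ‖x‖ - R / max R ‖y‖) • y := by
    simp only [radialRetraction, smul_sub, sub_smul]
    abel
  have h1 : ‖(R / max R ‖x‖) • (x - y)‖ ≤ ‖x - y‖ := by
    rw [norm_smul, Real.norm_of_nonneg (by positivity)]
    exact mul_le_of_le_one_left (norm_nonneg _) ((div_le_one hx).2 (le_max_left _ _))
  have h2 : ‖(R / max R ‖x‖ - R / max R ‖y‖) • y‖ ≤ ‖x - y‖ := by
    have h3 : |max R ‖y‖ - max R ‖x‖| ≤ ‖x - y‖ := by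
      refine (abs_max_sub_max_le_max _ _ _ _).trans ?_
      rw [sub_self, abs_zero, max_eq_right (abs_nonneg _), norm_sub_rev]
      exact abs_norm_sub_norm_le y x
    have h4 : R / max R ‖x‖ - R / max R ‖y‖ =
        (R / max R ‖x‖) * ((max R ‖y‖ - max R ‖x‖) / max R ‖y‖) := by
      field_simp
    rw [norm_smul, h4, Real.norm_eq_abs]
    simp only [abs_mul, abs_div, abs_of_pos hx, abs_of_pos hy, abs_of_pos hR]
    calc R / max R ‖x‖ * (|max R ‖y‖ - max R ‖x‖| / max R ‖y‖) * ‖y‖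
        ≤ 1 * (|max R ‖y‖ - max R ‖x‖| / max R ‖y‖) * max R ‖y‖ := by
          gcongr
          · exact (div_le_one hx).2 (le_max_left _ _)
          · exact le_max_right _ _
      _ = |max R ‖y‖ - max R ‖x‖| := by field_simp
      _ ≤ ‖x - y‖ := h3
  rw [e]
  linarith [norm_add_le ((R / max R ‖x‖) • (x - y)) ((R / max R ‖x‖ - R / max R ‖y‖) • y)]

end Retraction

/-- Composed with the radial retraction, the field is bounded and globally Lipschitz, so
Picard–Lindelöf covers the whole interval. The energy estimate keeps the solution in the ball where
the retraction is the identity. -/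
theorem exists_solvesOn (hF : PowerLipschitz a b F) {g : Cb × Cb} (hδ : 0 < γ - ‖g.2‖)
    (t₀ : ℝ) (ψ₀ : l2) {T : ℝ} (hT : 0 ≤ T) : ∃ ψ : ℝ → l2, ψ t₀ = ψ₀ ∧
      SolvesOn κ γ F g t₀ (t₀ + T) ψ ∧
      ∀ t ∈ Set.Ioo t₀ (t₀ + T), HasDerivAt ψ (field κ γ F g t (ψ t)) t := by
  obtain ⟨R, hR₁, hR₂⟩ : ∃ R, ‖ψ₀‖ < R ∧ ‖g.1‖ / (γ - ‖g.2‖) < R :=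
    ⟨max ‖ψ₀‖ (‖g.1‖ / (γ - ‖g.2‖)) + 1, (le_max_left _ _).trans_lt (lt_add_one _),
      (le_max_right _ _).trans_lt (lt_add_one _)⟩
  have hR : 0 < R := (norm_nonneg _).trans_lt hR₁
  set K := lipConst κ γ a b g R
  have hK : 0 ≤ K := lipConst_nonneg hF g hR.le
  set L := K * R + (1 + R) * ‖g‖
  have hL : 0 ≤ L := by positivity
  set f : ℝ → l2 → l2 := fun t x => field κ γ F g t (radialRetraction R x)
  -- At speed at most `L` a curve stays within `L * T` of `ψ₀`, so the length of the interval is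
  -- unrestricted. The factor `2` is the Lipschitz constant of the retraction.
  have hPL : IsPicardLindelof f (tmin := t₀) (tmax := t₀ + T)
      ⟨t₀, Set.left_mem_Icc.2 (by linarith)⟩ ψ₀
      (Real.toNNReal (L * T)) 0 (Real.toNNReal L) (Real.toNNReal (K * 2)) := by
    refine ⟨fun t _ => LipschitzOnWith.of_dist_le_mul fun x _ y _ => ?_,
      fun x _ => (continuous_field_left κ γ F g _).continuousOn, fun t _ x _ => ?_, ?_⟩
    · rw [dist_eq_norm, dist_eq_norm, Real.coe_toNNReal _ (by positivity), mul_assoc]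
      exact (norm_field_sub_field_le hF g t hR.le (norm_radialRetraction_le hR x)
        (norm_radialRetraction_le hR y)).trans
        (mul_le_mul_of_nonneg_left (norm_radialRetraction_sub_le hR x y) hK)
    · rw [Real.coe_toNNReal _ hL]
      exact norm_field_le hF g t hR.le (norm_radialRetraction_le hR x)
    · rw [Real.coe_toNNReal _ hL, Real.coe_toNNReal _ (by positivity)]
      simp [hT]
  obtain ⟨ψ, h0, hψ⟩ := hPL.exists_eq_forall_mem_Icc_hasDerivWithinAt₀
  have hc : ContinuousOn ψ (Set.Icc t₀ (t₀ + T)) := fun t ht => (hψ t ht).continuousWithinAt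
  have hd : ∀ t ∈ Set.Ico t₀ (t₀ + T), HasDerivWithinAt ψ (f t (ψ t)) (Set.Ici t) t :=
    fun t ht => (hψ t (Set.Ico_subset_Icc_self ht)).mono_of_mem_nhdsWithin
      (mem_of_superset (Icc_mem_nhdsGE ht.2) (Set.Icc_subset_Icc_left ht.1))
  have hb : ∀ t ∈ Set.Icc t₀ (t₀ + T), ‖ψ t‖ ^ 2 ≤ R ^ 2 := by
    refine image_le_of_deriv_right_lt_deriv_boundary' (hc.norm.pow 2)
      (fun t ht => (hd t ht).norm_sq) ?_ continuousOn_const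
      (fun t _ => hasDerivWithinAt_const t _ (R ^ 2)) fun t ht hB => ?_
    · have : ψ t₀ = ψ₀ := h0
      change ‖ψ t₀‖ ^ 2 ≤ R ^ 2
      rw [this]
      gcongr
    -- On the sphere of radius `R` the derivative of `‖ψ‖ ^ 2` is at most `2 R (‖g.1‖ - (γ - ‖g.2‖)
    -- R)`, negative by the choice of `R`.
    · have hn : ‖ψ t‖ = R := (pow_left_inj₀ (norm_nonneg _) hR.le two_ne_zero).1 hB
      have h1 := inner_field_le hF κ γ g t (ψ t)
      simp only [f, radialRetraction_of_norm_le hR hn.le]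
      rw [hn] at h1
      rw [div_lt_iff₀ hδ] at hR₂
      nlinarith
  have hb' : ∀ t ∈ Set.Icc t₀ (t₀ + T), f t (ψ t) = field κ γ F g t (ψ t) := fun t ht => by
    simp only [f]
    rw [radialRetraction_of_norm_le hR (le_of_sq_le_sq (hb t ht) hR.le)]
  refine ⟨ψ, h0, ⟨hc, fun t ht => ?_⟩, fun t ht => ?_⟩
  · rw [← hb' t (Set.Ico_subset_Icc_self ht)]
    exact hd t ht
  · rw [← hb' t (Set.Ioo_subset_Icc_self ht)]
    exact (hψ t (Set.Ioo_subset_Icc_self ht)).hasDerivAt (Icc_mem_nhds ht.1 ht.2)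

theorem exists_isSolution (hF : PowerLipschitz a b F) {g : Cb × Cb} (hδ : 0 < γ - ‖g.2‖)
    (t₀ : ℝ) (ψ₀ : l2) : ∃ ψ : ℝ → l2, IsSolution κ γ F g t₀ ψ₀ ψ := by
  choose u hu0 hu hud using fun n : ℕ =>
    exists_solvesOn (κ := κ) hF hδ t₀ ψ₀ (T := n) (Nat.cast_nonneg n)
  -- By uniqueness the solutions on longer and longer intervals agree, so at each time any interval
  -- containing it may be used.
  set ψ : ℝ → l2 := fun t => u (⌈t - t₀⌉₊) t
  have hψ : ∀ n : ℕ, Set.EqOn ψ (u n) (Set.Icc t₀ (t₀ + n)) := fun n t ht => by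
    have h1 : t ≤ t₀ + (⌈t - t₀⌉₊ : ℕ) := by linarith [Nat.le_ceil (t - t₀)]
    exact ((hu _).mono h1).eqOn hF ((hu n).mono ht.2) ((hu0 _).trans (hu0 n).symm)
      ⟨ht.1, le_rfl⟩
  have hlt : ∀ t, ∃ n : ℕ, t < t₀ + n := fun t => by
    obtain ⟨n, hn⟩ := exists_nat_gt (t - t₀)
    exact ⟨n, by linarith⟩
  refine ⟨ψ, (isSolution_iff hF).2 ⟨?_, fun t ht => ?_, fun t ht => ?_⟩⟩
  · rw [hψ 0 (by simp), hu0]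
  · obtain ⟨n, hn⟩ := hlt t
    have h1 : ContinuousWithinAt ψ (Set.Icc t₀ (t₀ + n)) t :=
      ((hu n).1 t ⟨ht, hn.le⟩).congr (hψ n) (hψ n ⟨ht, hn.le⟩)
    refine h1.mono_of_mem_nhdsWithin ?_
    rw [← Set.Ici_inter_Iic]
    exact inter_mem self_mem_nhdsWithin (mem_nhdsWithin_of_mem_nhds (Iic_mem_nhds hn))
  · obtain ⟨n, hn⟩ := hlt t
    rw [hψ n ⟨ht.le, hn.le⟩]
    exact (hud n t ⟨ht, hn⟩).congr_of_eventuallyEq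
      ((hψ n).eventuallyEq_of_mem (Icc_mem_nhds ht hn))

/-! ### The process and its translation identity -/

theorem isSolution_process (hF : PowerLipschitz a b F) {g : Cb × Cb} (hδ : 0 < γ - ‖g.2‖)
    (t₀ : ℝ) (ψ₀ : l2) :
    IsSolution κ γ F g t₀ ψ₀ fun t => process κ γ F g t t₀ ψ₀ :=
  Classical.epsilon_spec (exists_isSolution hF hδ t₀ ψ₀)

theorem IsSolution.eq_process (hF : PowerLipschitz a b F) {g : Cb × Cb} (hδ : 0 < γ - ‖g.2‖)
    {t₀ : ℝ} {ψ₀ : l2} {φ : ℝ → l2} (hφ : IsSolution κ γ F g t₀ ψ₀ φ) {t : ℝ} (ht : t₀ ≤ t) :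
    φ t = process κ γ F g t t₀ ψ₀ := by
  have h := isSolution_process (κ := κ) hF hδ t₀ ψ₀
  exact (hφ.solvesOn hF t).eqOn hF (h.solvesOn hF t) (hφ.1.trans h.1.symm) ⟨ht, le_rfl⟩

theorem process_self (hF : PowerLipschitz a b F) {g : Cb × Cb} (hδ : 0 < γ - ‖g.2‖)
    (t : ℝ) (x : l2) : process κ γ F g t t x = x :=
  (isSolution_process hF hδ t x).1

theorem process_process (hF : PowerLipschitz a b F) {g : Cb × Cb} (hδ : 0 < γ - ‖g.2‖)
    {r s t : ℝ} (hrs : r ≤ s) (hst : s ≤ t) (x : l2) :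
    process κ γ F g t s (process κ γ F g s r x) = process κ γ F g t r x := by
  have h := isSolution_process (κ := κ) hF hδ r x
  exact (IsSolution.eq_process hF hδ (φ := fun t => process κ γ F g t r x)
    ⟨rfl, h.2.1.mono (Set.Ici_subset_Ici.2 hrs),
      fun t ht => h.2.2 t (hrs.trans_lt ht)⟩ hst).symm

theorem norm_shift_le (h : ℝ) (f : Cb) : ‖shift h f‖ ≤ ‖f‖ :=
  (BoundedContinuousFunction.norm_le (norm_nonneg f)).2 fun t => f.norm_coe_le_norm (t + h)

theorem process_translate (hF : PowerLipschitz a b F) {g : Cb × Cb} (hδ : 0 < γ - ‖g.2‖)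
    {s t : ℝ} (hst : s ≤ t) (h : ℝ) (x : l2) :
    process κ γ F (translate h g) t s x = process κ γ F g (t + h) (s + h) x := by
  have hs := isSolution_process (κ := κ) hF hδ (s + h) x
  have hδ' : 0 < γ - ‖(translate h g).2‖ := by
    have : ‖(translate h g).2‖ ≤ ‖g.2‖ := norm_shift_le h g.2
    linarith
  refine (IsSolution.eq_process hF hδ' (φ := fun t => process κ γ F g (t + h) (s + h) x)
    ⟨hs.1, ?_, fun t ht => ?_⟩ hst).symm
  · exact hs.2.1.comp (by fun_prop) fun t ht => by simpa using ht
  · obtain ⟨v, hv, hn⟩ := hs.2.2 (t + h) (by linarith)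
    exact ⟨v, hv.comp_add_const t h, hn⟩


/-! ### Almost periodicity and compactness of the hull -/

theorem totallyBounded_of_forall_exists_isCompact {X : Type*} [PseudoMetricSpace X] {S : Set X}
    (h : ∀ ε > 0, ∃ K : Set X, IsCompact K ∧ ∀ x ∈ S, ∃ y ∈ K, dist x y < ε) :
    TotallyBounded S := by
  refine Metric.totallyBounded_iff.2 fun ε hε => ?_
  obtain ⟨K, hK, hSK⟩ := h (ε / 2) (half_pos hε)
  obtain ⟨t, ht, hKt⟩ := Metric.totallyBounded_iff.1 hK.totallyBounded (ε / 2) (half_pos hε)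
  refine ⟨t, ht, fun x hx => ?_⟩
  obtain ⟨y, hy, hxy⟩ := hSK x hx
  obtain ⟨z, hz, hyz⟩ := Set.mem_iUnion₂.1 (hKt hy)
  refine Set.mem_iUnion₂.2 ⟨z, hz, ?_⟩
  rw [Metric.mem_ball] at hyz ⊢
  linarith [dist_triangle x y z]

/-- An almost period in `[-t, -t + k]` carries `s` and `t` into `[-1, k + 1]`, where compactness
gives uniform continuity. -/
theorem AlmostPeriodic.exists_dist_lt {X : Type*} [MetricSpace X] {f : ℝ → X}
    (hf : AlmostPeriodic f) {ε : ℝ} (hε : 0 < ε) :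
    ∃ δ > 0, ∀ s t : ℝ, |s - t| < δ → dist (f s) (f t) < ε := by
  obtain ⟨k, hk, hτ⟩ := hf.2 (ε / 3) (by positivity)
  have hu : UniformContinuousOn f (Set.Icc (-1) (k + 1)) :=
    isCompact_Icc.uniformContinuousOn_of_continuous hf.1.continuousOn
  obtain ⟨δ, hδ, hδf⟩ := Metric.uniformContinuousOn_iff.1 hu (ε / 3) (by positivity)
  refine ⟨min δ 1, by positivity, fun s t hst => ?_⟩
  obtain ⟨τ, hτ₁, hτ₂⟩ := hτ (-t)
  have h1 := abs_lt.1 (hst.trans_le (min_le_right _ _))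
  have h2 : dist (f (s + τ)) (f (t + τ)) < ε / 3 := by
    refine hδf _ ⟨?_, ?_⟩ _ ⟨?_, ?_⟩ ?_
    · linarith [hτ₁.1]
    · linarith [hτ₁.2]
    · linarith [hτ₁.1]
    · linarith [hτ₁.2]
    · rw [Real.dist_eq, add_sub_add_right_eq_sub]
      exact hst.trans_le (min_le_left _ _)
  have h3 := hτ₂ s
  have h4 := hτ₂ t
  rw [dist_comm] at h3
  linarith [dist_triangle4 (f s) (f (s + τ)) (f (t + τ)) (f t)]

theorem AlmostPeriodic.continuous_shift {f : Cb} (hf : AlmostPeriodic (f : ℝ → l2)) :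
    Continuous fun h => shift h f := by
  refine Metric.continuous_iff.2 fun h ε hε => ?_
  obtain ⟨δ, hδ, hd⟩ := hf.exists_dist_lt (half_pos hε)
  refine ⟨δ, hδ, fun h' hh => lt_of_le_of_lt ?_ (half_lt_self hε)⟩
  refine (BoundedContinuousFunction.dist_le (by positivity)).2 fun t => ?_
  rw [shift_apply, shift_apply]
  refine (hd _ _ ?_).le
  rwa [add_sub_add_left_eq_sub, ← Real.dist_eq]

/-- An almost period brings any shift `h` to `h + τ ∈ [0, k]` at small cost, and shifts from `[0,
k]` form a compact set. -/
theorem AlmostPeriodic.totallyBounded_range_shift {f : Cb} (hf : AlmostPeriodic (f : ℝ → l2)) :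
    TotallyBounded (Set.range fun h => shift h f) := by
  refine totallyBounded_of_forall_exists_isCompact fun ε hε => ?_
  obtain ⟨k, -, hτ⟩ := hf.2 (ε / 2) (half_pos hε)
  refine ⟨(fun h => shift h f) '' Set.Icc 0 k, isCompact_Icc.image hf.continuous_shift, ?_⟩
  rintro _ ⟨h, rfl⟩
  obtain ⟨τ, hτ₁, hτ₂⟩ := hτ (-h)
  refine ⟨_, ⟨h + τ, ⟨by linarith [hτ₁.1], by linarith [hτ₁.2]⟩, rfl⟩,
    lt_of_le_of_lt ?_ (half_lt_self hε)⟩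
  refine (BoundedContinuousFunction.dist_le (by positivity)).2 fun t => ?_
  rw [shift_apply, shift_apply, dist_comm, ← add_assoc]
  exact (hτ₂ (t + h)).le

theorem isCompact_hull {g₀ : Cb × Cb} (hg₁ : AlmostPeriodic (g₀.1 : ℝ → l2))
    (hg₂ : AlmostPeriodic (g₀.2 : ℝ → l2)) : IsCompact (hull g₀) := by
  have hK : IsCompact (closure (Set.range fun h => shift h g₀.1) ×ˢ
      closure (Set.range fun h => shift h g₀.2)) :=
    (hg₁.totallyBounded_range_shift.closure.isCompact_of_isClosed isClosed_closure).prod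
    (hg₂.totallyBounded_range_shift.closure.isCompact_of_isClosed isClosed_closure)
  refine hK.of_isClosed_subset isClosed_closure (closure_minimal ?_ hK.isClosed)
  rintro _ ⟨h, rfl⟩
  exact ⟨subset_closure ⟨h, rfl⟩, subset_closure ⟨h, rfl⟩⟩

theorem norm_le_of_mem_hull {g₀ g : Cb × Cb} (hg : g ∈ hull g₀) :
    ‖g.1‖ ≤ ‖g₀.1‖ ∧ ‖g.2‖ ≤ ‖g₀.2‖ := by
  have hc : IsClosed {g : Cb × Cb | ‖g.1‖ ≤ ‖g₀.1‖ ∧ ‖g.2‖ ≤ ‖g₀.2‖} :=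
    (isClosed_le continuous_fst.norm continuous_const).inter
      (isClosed_le continuous_snd.norm continuous_const)
  refine closure_minimal ?_ hc hg
  rintro _ ⟨h, rfl⟩
  exact ⟨norm_shift_le h _, norm_shift_le h _⟩

/-! ### Existence of global attractors -/

section Attractor

variable {X : Type*} [MetricSpace X]

/-- `S` is asymptotically compact on `B`. -/
def AsymptoticallyCompactOn (S : ℝ → X → X) (B : Set X) : Prop :=
  ∀ (t : ℕ → ℝ) (p : ℕ → X), Tendsto t atTop atTop → (∀ n, p n ∈ B) →
    ∃ y, ∃ φ : ℕ → ℕ, StrictMono φ ∧ Tendsto (fun n => S (t (φ n)) (p (φ n))) atTop (𝓝 y)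

/-- The `ω`-limit set of `B`, described by sequences. -/
def seqOmegaLimit (S : ℝ → X → X) (B : Set X) : Set X :=
  {y | ∃ (t : ℕ → ℝ) (p : ℕ → X), Tendsto t atTop atTop ∧ (∀ n, p n ∈ B) ∧
    Tendsto (fun n => S (t n) (p n)) atTop (𝓝 y)}

theorem isCompact_seqOmegaLimit {S : ℝ → X → X} {B : Set X} (hB : AsymptoticallyCompactOn S B) :
    IsCompact (seqOmegaLimit S B) := by
  refine IsSeqCompact.isCompact fun y hy => ?_
  choose t p ht hp hlim using hy
  have hex : ∀ n : ℕ, ∃ m, (n : ℝ) ≤ t n m ∧ dist (S (t n m) (p n m)) (y n) < 1 / ((n : ℝ) + 1) :=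
    fun n => ((ht n).eventually_ge_atTop (n : ℝ) |>.and
      ((tendsto_iff_dist_tendsto_zero.1 (hlim n)).eventually_lt_const
        Nat.one_div_pos_of_nat)).exists
  choose m hm₁ hm₂ using hex
  have htm : Tendsto (fun n => t n (m n)) atTop atTop :=
    tendsto_atTop_mono hm₁ tendsto_natCast_atTop_atTop
  obtain ⟨z, φ, hφ, hz⟩ := hB _ (fun n => p n (m n)) htm fun n => hp n _
  refine ⟨z, ⟨_, _, htm.comp hφ.tendsto_atTop, fun n => hp (φ n) _, hz⟩, φ, hφ, ?_⟩
  refine tendsto_of_tendsto_of_dist hz (squeeze_zero (fun _ => dist_nonneg)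
    (fun n => (hm₂ (φ n)).le) ?_)
  exact tendsto_one_div_add_atTop_nhds_zero_nat.comp hφ.tendsto_atTop

/-- For the inclusion `⊇`, asymptotic compactness at the times `t n - s` yields a limit point that
`S s` maps to the given one. -/
theorem image_seqOmegaLimit {S : ℝ → X → X} {B : Set X} (hB : AsymptoticallyCompactOn S B)
    (hS : ∀ s t, 0 ≤ s → 0 ≤ t → ∀ p, S (s + t) p = S s (S t p))
    (hc : ∀ t, 0 ≤ t → Continuous (S t)) {s : ℝ} (hs : 0 ≤ s) :
    S s '' seqOmegaLimit S B = seqOmegaLimit S B := by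
  refine Set.Subset.antisymm ?_ ?_
  · rintro _ ⟨y, ⟨t, p, ht, hp, hlim⟩, rfl⟩
    refine ⟨fun n => s + t n, p, tendsto_atTop_add_const_left _ s ht, hp, ?_⟩
    refine (((hc s hs).tendsto y).comp hlim).congr' ?_
    filter_upwards [ht.eventually_ge_atTop 0] with n hn
    exact (hS s (t n) hs hn (p n)).symm
  · rintro y ⟨t, p, ht, hp, hlim⟩
    have ht' : Tendsto (fun n => t n - s) atTop atTop := tendsto_atTop_add_const_right _ (-s) ht
    obtain ⟨z, φ, hφ, hz⟩ := hB _ p ht' hp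
    refine ⟨z, ⟨_, _, ht'.comp hφ.tendsto_atTop, fun n => hp (φ n), hz⟩, ?_⟩
    refine tendsto_nhds_unique (((hc s hs).tendsto z).comp hz)
      ((hlim.comp hφ.tendsto_atTop).congr' ?_)
    filter_upwards [(ht.comp hφ.tendsto_atTop).eventually_ge_atTop s] with n hn
    have := hS s (t (φ n) - s) hs (sub_nonneg.2 hn) (p (φ n))
    rwa [add_sub_cancel] at this

theorem exists_isGlobalAttractor {S : ℝ → X → X} {B₀ : Set X}
    (hS : ∀ s t, 0 ≤ s → 0 ≤ t → ∀ p, S (s + t) p = S s (S t p))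
    (hc : ∀ t, 0 ≤ t → Continuous (S t))
    (habs : ∀ B, Bornology.IsBounded B → ∃ T, 0 ≤ T ∧ ∀ t, T ≤ t → Set.MapsTo (S t) B B₀)
    (hB : AsymptoticallyCompactOn S B₀) : ∃ A, IsGlobalAttractor S A := by
  refine ⟨seqOmegaLimit S B₀, isCompact_seqOmegaLimit hB,
    fun s hs => image_seqOmegaLimit hB hS hc hs, fun B hBb => ?_⟩
  obtain ⟨T, hT, hTB⟩ := habs B hBb
  refine ENNReal.tendsto_nhds_zero.2 fun ε hε => ?_
  by_contra hcon
  have hex : ∀ n : ℕ, ∃ t, (n : ℝ) + T ≤ t ∧ ∃ p ∈ B, ε < Metric.infEDist (S t p)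
      (seqOmegaLimit S B₀) := fun n => by
    obtain ⟨t, hlt, ht⟩ := ((not_eventually.1 hcon).and_eventually
      (eventually_ge_atTop ((n : ℝ) + T))).exists
    obtain ⟨_, hu⟩ := lt_iSup_iff.1 (not_le.1 hlt)
    obtain ⟨⟨p, hp, rfl⟩, hu⟩ := lt_iSup_iff.1 hu
    exact ⟨t, ht, p, hp, hu⟩
  choose t ht p hp hlt using hex
  have ht' : Tendsto (fun n => t n - T) atTop atTop :=
    tendsto_atTop_mono (fun n => by linarith [ht n]) tendsto_natCast_atTop_atTop
  -- The points far from the limit set are in `B₀` after time `T`. The remaining run `t n - T` has a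
  -- convergent subsequence, whose limit lies in the limit set: a contradiction.
  obtain ⟨y, φ, hφ, hy⟩ := hB _ (fun n => S T (p n)) ht' fun n => hTB T le_rfl (hp n)
  have hyA : y ∈ seqOmegaLimit S B₀ :=
    ⟨_, _, ht'.comp hφ.tendsto_atTop, fun n => hTB T le_rfl (hp (φ n)), hy⟩
  have hev := (tendsto_iff_edist_tendsto_0.1 hy).eventually_lt_const hε
  obtain ⟨n, hn⟩ := hev.exists
  have hTn : 0 ≤ t (φ n) - T := by linarith [ht (φ n), Nat.cast_nonneg (α := ℝ) (φ n)]
  rw [← hS _ _ hTn hT, sub_add_cancel] at hn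
  exact absurd ((hlt (φ n)).trans_le (Metric.infEDist_le_edist_of_mem hyA)) hn.not_gt

end Attractor


/-! ### Absorbing ball and continuity of the process -/

theorem le_exp_mul_add_of_hasDerivAt_le {y y' : ℝ → ℝ} {s α c : ℝ} (hα : 0 < α) (hc : 0 ≤ c)
    (hy : ContinuousOn y (Set.Ici s)) (hd : ∀ t, s < t → HasDerivAt y (y' t) t)
    (hle : ∀ t, s < t → y' t ≤ -α * y t + c) {t : ℝ} (ht : s ≤ t) :
    y t ≤ Real.exp (-α * (t - s)) * y s + c / α := by
  set z : ℝ → ℝ := fun t => (y t - c / α) * Real.exp (α * (t - s))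
  have hz : AntitoneOn z (Set.Ici s) := by
    have hdz : ∀ t, s < t → HasDerivAt z
        (y' t * Real.exp (α * (t - s)) + (y t - c / α) * (Real.exp (α * (t - s)) * (α * 1))) t :=
      fun t ht => ((hd t ht).sub_const _).mul
        ((((hasDerivAt_id t).sub_const s).const_mul α).exp)
    refine antitoneOn_of_deriv_nonpos (convex_Ici s)
      ((hy.sub continuousOn_const).mul (by fun_prop)) ?_ ?_
    · rw [interior_Ici]
      exact fun t ht => (hdz t ht).differentiableAt.differentiableWithinAt
    · rw [interior_Ici]
      intro t ht
      rw [(hdz t ht).deriv]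
      have e : y' t * Real.exp (α * (t - s)) + (y t - c / α) * (Real.exp (α * (t - s)) * (α * 1)) =
          (y' t + α * y t - c) * Real.exp (α * (t - s)) := by
        field_simp
        ring
      rw [e]
      exact mul_nonpos_of_nonpos_of_nonneg (by linarith [hle t ht]) (Real.exp_pos _).le
  have h1 := hz Set.self_mem_Ici ht ht
  simp only [z, sub_self, mul_zero, Real.exp_zero, mul_one] at h1
  have h2 := mul_le_mul_of_nonneg_right h1 (Real.exp_pos (-α * (t - s))).le
  have h3 : Real.exp (α * (t - s)) * Real.exp (-α * (t - s)) = 1 := by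
    rw [← Real.exp_add]
    simp
  rw [mul_assoc, h3, mul_one] at h2
  have h4 : 0 ≤ c / α * Real.exp (-α * (t - s)) := by positivity
  linarith

variable {g₀ g : Cb × Cb}

theorem damping_pos_of_mem_hull (hδ : 0 < γ - ‖g₀.2‖) (hg : g ∈ hull g₀) : 0 < γ - ‖g.2‖ := by
  linarith [(norm_le_of_mem_hull hg).2]

/-- Of the damping rate `2 δ` for `‖ψ‖ ^ 2`, with `δ = γ - ‖g₀.2‖`, Young's inequality spends one
`δ` on the forcing. -/
theorem norm_sq_process_le (hF : PowerLipschitz a b F) (hδ : 0 < γ - ‖g₀.2‖)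
    (hg : g ∈ hull g₀) {s t : ℝ} (hst : s ≤ t) (x : l2) :
    ‖process κ γ F g t s x‖ ^ 2 ≤ Real.exp (-(γ - ‖g₀.2‖) * (t - s)) * ‖x‖ ^ 2
      + (‖g₀.1‖ / (γ - ‖g₀.2‖)) ^ 2 := by
  obtain ⟨h0, hc, hd⟩ := (isSolution_iff hF).1
    (isSolution_process (κ := κ) hF (damping_pos_of_mem_hull hδ hg) s x)
  set δ := γ - ‖g₀.2‖ with hδdef
  have key := le_exp_mul_add_of_hasDerivAt_le (y := fun t => ‖process κ γ F g t s x‖ ^ 2)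
    (c := ‖g₀.1‖ ^ 2 / δ) hδ (by positivity)
    (hc.norm.pow 2) (fun t ht => (hd t ht).norm_sq) (fun t _ => ?_) hst
  · simp only [process_self hF (damping_pos_of_mem_hull hδ hg)] at key
    refine key.trans (le_of_eq ?_)
    field_simp
  · set ψ := process κ γ F g t s x
    have h1 := inner_field_le hF κ γ g t ψ
    obtain ⟨h2, h3⟩ := norm_le_of_mem_hull hg
    have h4 : ‖g.1‖ * ‖ψ‖ ≤ ‖g₀.1‖ * ‖ψ‖ := mul_le_mul_of_nonneg_right h2 (norm_nonneg _)
    have h5 : ‖g.2‖ * ‖ψ‖ ^ 2 ≤ ‖g₀.2‖ * ‖ψ‖ ^ 2 := mul_le_mul_of_nonneg_right h3 (by positivity)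
    have h6 : 2 * (‖g₀.1‖ * ‖ψ‖) ≤ δ * ‖ψ‖ ^ 2 + ‖g₀.1‖ ^ 2 / δ := by
      have : δ * ‖ψ‖ ^ 2 + ‖g₀.1‖ ^ 2 / δ - 2 * (‖g₀.1‖ * ‖ψ‖) = (δ * ‖ψ‖ - ‖g₀.1‖) ^ 2 / δ := by
        field_simp
        ring
      have h7 : 0 ≤ (δ * ‖ψ‖ - ‖g₀.1‖) ^ 2 / δ := by positivity
      linarith
    rw [hδdef] at h6 ⊢
    linarith

theorem norm_process_le (hF : PowerLipschitz a b F) (hδ : 0 < γ - ‖g₀.2‖)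
    (hg : g ∈ hull g₀) {s t : ℝ} (hst : s ≤ t) (x : l2) :
    ‖process κ γ F g t s x‖ ≤ ‖x‖ + ‖g₀.1‖ / (γ - ‖g₀.2‖) := by
  have hm : 0 ≤ ‖g₀.1‖ / (γ - ‖g₀.2‖) := by positivity
  refine le_of_sq_le_sq ((norm_sq_process_le hF hδ hg hst x).trans ?_) (by positivity)
  have h1 : Real.exp (-(γ - ‖g₀.2‖) * (t - s)) ≤ 1 := by
    rw [Real.exp_le_one_iff]
    nlinarith
  have h2 := mul_le_mul_of_nonneg_right h1 (sq_nonneg ‖x‖)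
  nlinarith [mul_nonneg (norm_nonneg x) hm]

/-- The radius of an absorbing ball of the family of processes. -/
noncomputable def absorbingRadius (γ : ℝ) (g₀ : Cb × Cb) : ℝ := ‖g₀.1‖ / (γ - ‖g₀.2‖) + 1

theorem exists_norm_process_le_absorbingRadius (hF : PowerLipschitz a b F)
    (hδ : 0 < γ - ‖g₀.2‖) (r : ℝ) : ∃ T, 0 ≤ T ∧ ∀ g ∈ hull g₀, ∀ s t : ℝ, T ≤ t - s →
      ∀ x : l2, ‖x‖ ≤ r → ‖process κ γ F g t s x‖ ≤ absorbingRadius γ g₀ := by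
  have hlim : Tendsto (fun u : ℝ => Real.exp (-(γ - ‖g₀.2‖) * u) * r ^ 2) atTop (𝓝 0) := by
    have h1 : Tendsto (fun u : ℝ => -(γ - ‖g₀.2‖) * u) atTop atBot :=
      tendsto_id.const_mul_atTop_of_neg (neg_lt_zero.2 hδ)
    simpa using (Real.tendsto_exp_atBot.comp h1).mul_const (r ^ 2)
  obtain ⟨T, hT⟩ := eventually_atTop.1 (hlim.eventually_le_const zero_lt_one)
  refine ⟨max T 0, le_max_right _ _, fun g hg s t hst x hx => ?_⟩
  have hm : 0 ≤ ‖g₀.1‖ / (γ - ‖g₀.2‖) := by positivity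
  have h1 := norm_sq_process_le (κ := κ) hF hδ hg
    (sub_nonneg.1 ((le_max_right _ _).trans hst)) x
  have h2 := hT (t - s) ((le_max_left _ _).trans hst)
  have h3 : Real.exp (-(γ - ‖g₀.2‖) * (t - s)) * ‖x‖ ^ 2 ≤
      Real.exp (-(γ - ‖g₀.2‖) * (t - s)) * r ^ 2 := by
    gcongr
  refine le_of_sq_le_sq ?_ (by unfold absorbingRadius; positivity)
  unfold absorbingRadius
  nlinarith

theorem continuous_process (hF : PowerLipschitz a b F) (hδ : 0 < γ - ‖g₀.2‖) {s t : ℝ}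
    (hst : s ≤ t) : Continuous fun p : l2 × hull g₀ => process κ γ F p.2 t s p.1 := by
  refine continuous_iff_continuousAt.2 fun p => ?_
  -- Bounds, for every symbol in the hull, all trajectories from data of norm at most `‖p.1‖ + 1`,
  -- hence from all data near `p`.
  set R := ‖p.1‖ + 1 + ‖g₀.1‖ / (γ - ‖g₀.2‖)
  set K := lipConst κ γ a b (p.2 : Cb × Cb) R
  have hcont : Continuous fun q : l2 × hull g₀ =>
      gronwallBound ‖p.1 - q.1‖ K ((1 + R) * ‖(p.2 : Cb × Cb) - q.2‖) (t - s) := by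
    by_cases hK : K = 0
    · simp only [hK, gronwallBound_K0]
      fun_prop
    · simp only [gronwallBound_of_K_ne_0 hK]
      fun_prop
  have hlim := hcont.tendsto p
  simp only [sub_self, norm_zero, mul_zero] at hlim
  rw [← sub_self s, sub_self s, gronwallBound_ε0_δ0] at hlim
  refine tendsto_iff_dist_tendsto_zero.2 (squeeze_zero' (Eventually.of_forall fun _ => dist_nonneg)
    ?_ hlim)
  have hev : ∀ᶠ q : l2 × hull g₀ in 𝓝 p, ‖q.1‖ < ‖p.1‖ + 1 :=
    continuous_fst.norm.continuousAt.eventually_lt_const (lt_add_one _)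
  filter_upwards [hev] with q hq
  rw [dist_comm, dist_eq_norm]
  have hp := damping_pos_of_mem_hull hδ p.2.2
  have hq' := damping_pos_of_mem_hull hδ q.2.2
  have := norm_sub_le_of_solvesOn hF (R := R)
    ((isSolution_process (κ := κ) hF hp s p.1).solvesOn hF t)
    ((isSolution_process (κ := κ) hF hq' s q.1).solvesOn hF t)
    (fun u hu => (norm_process_le hF hδ p.2.2 hu.1 p.1).trans (by simp only [R]; linarith))
    (fun u hu => (norm_process_le hF hδ q.2.2 hu.1 q.1).trans (by simp only [R]; linarith))
    t ⟨hst, le_rfl⟩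
  simpa only [process_self hF hp, process_self hF hq'] using this

/-! ### Tail estimates -/

/-- A slowly varying sequence which vanishes at `0` and equals `1` far from the origin. -/
noncomputable def tailWeight (k : ℕ) (n : ℤ) : ℝ := min 1 (|(n : ℝ)| / (k + 1))

theorem tailWeight_nonneg (k : ℕ) (n : ℤ) : 0 ≤ tailWeight k n :=
  le_min zero_le_one (by positivity)

theorem abs_tailWeight_le (k : ℕ) (n : ℤ) : |tailWeight k n| ≤ 1 := by
  rw [abs_of_nonneg (tailWeight_nonneg k n)]
  exact min_le_left _ _

theorem abs_tailWeight_sub_le (k : ℕ) (n : ℤ) :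
    |tailWeight k (n + 1) - tailWeight k n| ≤ 1 / ((k : ℝ) + 1) := by
  have hk : (0 : ℝ) < k + 1 := by positivity
  refine (abs_min_sub_min_le_max _ _ _ _).trans (max_le (by simp; positivity) ?_)
  rw [← sub_div, abs_div, abs_of_pos hk]
  gcongr
  refine (abs_abs_sub_abs_le _ _).trans ?_
  simp

theorem tailWeight_eq_one {k : ℕ} {n : ℤ} (h : (k : ℝ) + 1 ≤ |(n : ℝ)|) : tailWeight k n = 1 :=
  min_eq_left ((one_le_div (by positivity)).2 h)

/-- Multiplication by `tailWeight k`, which detects the tails of a sequence. -/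
noncomputable def tail (k : ℕ) : l2 →L[ℝ] l2 := diag (tailWeight k) (abs_tailWeight_le k)

theorem norm_sq_eq_tsum (x : l2) : ‖x‖ ^ 2 = ∑' n, ‖x n‖ ^ 2 := by
  rw [← real_inner_self_eq_norm_sq, lp.inner_eq_tsum]
  simp only [real_inner_self_eq_norm_sq]

theorem tendsto_tail (x : l2) : Tendsto (fun k => tail k x) atTop (𝓝 0) := by
  have hs : Summable fun n => ‖x n‖ ^ 2 := by
    have := lp.summable_inner (𝕜 := ℝ) x x
    simpa only [real_inner_self_eq_norm_sq] using this
  have h : Tendsto (fun k => ‖tail k x‖ ^ 2) atTop (𝓝 0) := by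
    simp only [norm_sq_eq_tsum]
    rw [← tsum_zero (α := ℝ) (β := ℤ)]
    refine tendsto_tsum_of_dominated_convergence hs (fun n => ?_)
      (Eventually.of_forall fun k n => ?_)
    · have h1 : Tendsto (fun k : ℕ => |(n : ℝ)| / ((k : ℝ) + 1)) atTop (𝓝 0) :=
        tendsto_const_nhds.div_atTop
          (tendsto_atTop_add_const_right _ _ tendsto_natCast_atTop_atTop)
      have h2 : Tendsto (fun k => tailWeight k n) atTop (𝓝 0) := by
        simpa [tailWeight] using (tendsto_const_nhds (x := (1 : ℝ))).min h1
      have h3 : Tendsto (fun k => (tailWeight k n : ℂ) * x n) atTop (𝓝 0) := by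
        simpa using ((Complex.continuous_ofReal.tendsto 0).comp h2).mul_const (x n)
      simpa [tail] using h3.norm.pow 2
    · rw [norm_pow, norm_norm]
      have : ‖tail k x n‖ ≤ ‖x n‖ := by
        rw [tail, diag_apply, norm_mul, Complex.norm_real]
        exact mul_le_of_le_one_left (norm_nonneg _) (abs_tailWeight_le k n)
      gcongr
  rw [tendsto_zero_iff_norm_tendsto_zero]
  have := h.sqrt
  simpa [Real.sqrt_sq] using this

theorem eventually_norm_tail_le_of_isCompact {C : Set l2} (hC : IsCompact C) {ε : ℝ}
    (hε : 0 < ε) : ∀ᶠ k in atTop, ∀ x ∈ C, ‖tail k x‖ ≤ ε := by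
  obtain ⟨t, ht, hCt⟩ := Metric.totallyBounded_iff.1 hC.totallyBounded (ε / 2) (half_pos hε)
  have hev : ∀ᶠ k in atTop, ∀ y ∈ t, ‖tail k y‖ < ε / 2 :=
    (eventually_all_finite ht).2 fun y _ =>
      (tendsto_zero_iff_norm_tendsto_zero.1 (tendsto_tail y)).eventually_lt_const (half_pos hε)
  filter_upwards [hev] with k hk x hx
  obtain ⟨y, hy, hxy⟩ := Set.mem_iUnion₂.1 (hCt hx)
  have h1 : ‖tail k (x - y)‖ ≤ ‖x - y‖ := norm_diag_le _ _ _
  rw [Metric.mem_ball, dist_eq_norm] at hxy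
  have h2 := norm_add_le (tail k (x - y)) (tail k y)
  rw [← map_add, sub_add_cancel] at h2
  linarith [hk y hy]

/-- Each `g.1 t` is the value at `0` of a translate, so all of them lie in a continuous image of the
compact hull. -/
theorem eventually_norm_tail_hull_le (hH : IsCompact (hull g₀)) {ε : ℝ} (hε : 0 < ε) :
    ∀ᶠ k in atTop, ∀ g ∈ hull g₀, ∀ t : ℝ, ‖tail k (g.1 t)‖ ≤ ε := by
  have hc : Continuous fun g : Cb × Cb => g.1 0 := by fun_prop
  filter_upwards [eventually_norm_tail_le_of_isCompact (hH.image hc) hε] with k hk g hg t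
  refine hk _ ⟨translate t g, translate_mem_hull t hg, ?_⟩
  change g.1 (0 + t) = g.1 t
  rw [zero_add]

theorem norm_sq_tail_process_le (hF : PowerLipschitz a b F) (hδ : 0 < γ - ‖g₀.2‖)
    (hg : g ∈ hull g₀) {k : ℕ} {ε : ℝ} (hε : 0 ≤ ε) (hk : ∀ t, ‖tail k (g.1 t)‖ ≤ ε)
    {s t r : ℝ} (hr : 0 ≤ r) (hst : s ≤ t) {x : l2} (hx : ‖x‖ ≤ r) :
    ‖tail k (process κ γ F g t s x)‖ ^ 2 ≤
      Real.exp (-(2 * (γ - ‖g₀.2‖)) * (t - s)) * r ^ 2 +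
        (2 * ε * (r + ‖g₀.1‖ / (γ - ‖g₀.2‖))
          + 4 * |κ| * (1 / ((k : ℝ) + 1)) * (r + ‖g₀.1‖ / (γ - ‖g₀.2‖)) ^ 2)
          / (2 * (γ - ‖g₀.2‖)) := by
  obtain ⟨-, hc, hd⟩ := (isSolution_iff hF).1
    (isSolution_process (κ := κ) hF (damping_pos_of_mem_hull hδ hg) s x)
  set δ := γ - ‖g₀.2‖ with hδdef
  set m := r + ‖g₀.1‖ / δ
  have hm : 0 ≤ m := by positivity
  have hd' : ∀ t, s < t → HasDerivAt (fun t => tail k (process κ γ F g t s x))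
      (tail k (field κ γ F g t (process κ γ F g t s x))) t :=
    fun t ht => (tail k).hasFDerivAt.comp_hasDerivAt t (hd t ht)
  have key := le_exp_mul_add_of_hasDerivAt_le (α := 2 * δ)
    (y := fun t => ‖tail k (process κ γ F g t s x)‖ ^ 2)
    (c := 2 * ε * m + 4 * |κ| * (1 / ((k : ℝ) + 1)) * m ^ 2) (by positivity) (by positivity)
    (((tail k).continuous.comp_continuousOn hc).norm.pow 2)
    (fun t ht => (hd' t ht).norm_sq) (fun t ht => ?_) hst
  · refine key.trans (add_le_add_left (mul_le_mul_of_nonneg_left ?_ (Real.exp_pos _).le) _)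
    simp only [process_self hF (damping_pos_of_mem_hull hδ hg)]
    have : ‖tail k x‖ ≤ r := (norm_diag_le _ _ _).trans hx
    gcongr
  · have hψ : ‖process κ γ F g t s x‖ ≤ m :=
      (norm_process_le hF hδ hg ht.le x).trans (add_le_add_left hx _)
    set ψ := process κ γ F g t s x
    have h1 : inner ℝ (tail k ψ) (tail k (field κ γ F g t ψ)) ≤ _ :=
      inner_diag_field_le hF κ γ g t (abs_tailWeight_le k) (abs_tailWeight_sub_le k) ψ
    change _ ≤ -(γ - ‖g.2‖) * ‖tail k ψ‖ ^ 2 + ‖tail k (g.1 t)‖ * ‖tail k ψ‖ + _ at h1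
    have h2 : ‖tail k (g.1 t)‖ * ‖tail k ψ‖ ≤ ε * m :=
      mul_le_mul (hk t) ((norm_diag_le _ _ _).trans hψ) (norm_nonneg _) hε
    have h3 : ‖g.2‖ * ‖tail k ψ‖ ^ 2 ≤ ‖g₀.2‖ * ‖tail k ψ‖ ^ 2 :=
      mul_le_mul_of_nonneg_right (norm_le_of_mem_hull hg).2 (by positivity)
    have h4 : 2 * |κ| * (1 / ((k : ℝ) + 1)) * ‖ψ‖ ^ 2 ≤
        2 * |κ| * (1 / ((k : ℝ) + 1)) * m ^ 2 := by
      gcongr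
    rw [hδdef]
    linarith

/-- The weight is `1` for `|n| ≥ k + 1`, so `x - tail k x` has only finitely many coordinates, all
bounded. -/
theorem exists_isCompact_sub_tail_mem (k : ℕ) (r : ℝ) :
    ∃ K : Set l2, IsCompact K ∧ ∀ x : l2, ‖x‖ ≤ r → x - tail k x ∈ K := by
  set Φ : (ℤ → ℂ) → l2 := fun c => ∑ n ∈ Finset.Icc (-(k : ℤ)) k,
    lp.single 2 n (((1 - tailWeight k n : ℝ) : ℂ) * c n) with hΦdef
  have hΦ : Continuous Φ := continuous_finsetSum _ fun n _ =>
    (lp.isometry_single (E := fun _ : ℤ => ℂ) (p := 2) n).continuous.comp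
      (continuous_const.mul (continuous_apply n))
  refine ⟨Φ '' Set.univ.pi fun _ => Metric.closedBall 0 r,
    (isCompact_univ_pi fun _ => isCompact_closedBall _ _).image hΦ, fun x hx => ?_⟩
  refine ⟨fun n => x n, fun n _ => mem_closedBall_zero_iff.2 ((norm_apply_le x n).trans hx), ?_⟩
  refine lp.ext <| funext fun n => ?_
  rw [hΦdef, lp.coeFn_sum, Finset.sum_apply]
  simp only [lp.single_apply, sub_apply, tail, diag_apply]
  by_cases hn : n ∈ Finset.Icc (-(k : ℤ)) k
  · rw [Finset.sum_eq_single_of_mem n hn fun m _ hm => Pi.single_eq_of_ne hm.symm _,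
      Pi.single_eq_same]
    push_cast
    ring
  · rw [Finset.sum_eq_zero fun m hm => Pi.single_eq_of_ne (by rintro rfl; exact hn hm) _]
    have h1 : (k : ℤ) + 1 ≤ |n| := by
      by_contra h
      exact hn (Finset.mem_Icc.2 (abs_le.1 (by omega)))
    rw [tailWeight_eq_one (by exact_mod_cast h1)]
    simp

theorem exists_isCompact_approx_process (hF : PowerLipschitz a b F) (hδ : 0 < γ - ‖g₀.2‖)
    (hH : IsCompact (hull g₀)) {r ε : ℝ} (hr : 0 ≤ r) (hε : 0 < ε) :
    ∃ (T : ℝ) (K : Set l2), IsCompact K ∧ ∀ g ∈ hull g₀, ∀ t, T ≤ t → ∀ x : l2, ‖x‖ ≤ r →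
      ∃ y ∈ K, dist (process κ γ F g t 0 x) y < ε := by
  set δ := γ - ‖g₀.2‖
  set m := r + ‖g₀.1‖ / δ
  have hm : 0 ≤ m := by positivity
  -- Forcing tail and commutator get `δ * ε ^ 2 / 2` each; divided by `2 * δ` they total `ε ^ 2 /
  -- 2`, and the decaying exponential takes the other half.
  obtain ⟨ε', hε', hsmall⟩ : ∃ ε' > 0, 2 * ε' * m < δ * ε ^ 2 / 2 := by
    refine ⟨δ * ε ^ 2 / (8 * (m + 1)), by positivity, ?_⟩
    have : 2 * (δ * ε ^ 2 / (8 * (m + 1))) * m = δ * ε ^ 2 / 4 * (m / (m + 1)) := by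
      field_simp
      ring
    rw [this]
    have h1 : m / (m + 1) ≤ 1 := (div_le_one (by positivity)).2 (by linarith)
    have h2 : 0 < δ * ε ^ 2 := by positivity
    nlinarith
  have hlim : Tendsto (fun k : ℕ => 4 * |κ| * (1 / ((k : ℝ) + 1)) * m ^ 2) atTop (𝓝 0) := by
    simpa using (tendsto_one_div_add_atTop_nhds_zero_nat.const_mul (4 * |κ|)).mul_const (m ^ 2)
  obtain ⟨k, hk₁, hk₂⟩ := ((eventually_norm_tail_hull_le hH hε').and
    (hlim.eventually_lt_const (by positivity : 0 < δ * ε ^ 2 / 2))).exists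
  have hexp : Tendsto (fun u : ℝ => Real.exp (-(2 * δ) * (u - 0)) * r ^ 2) atTop (𝓝 0) := by
    have h1 : Tendsto (fun u : ℝ => -(2 * δ) * (u - 0)) atTop atBot := by
      simp only [sub_zero]
      exact tendsto_id.const_mul_atTop_of_neg (by linarith)
    simpa using (Real.tendsto_exp_atBot.comp h1).mul_const (r ^ 2)
  obtain ⟨T, hT⟩ := eventually_atTop.1
    (hexp.eventually_lt_const (by positivity : 0 < ε ^ 2 / 2))
  obtain ⟨K, hK, hKx⟩ := exists_isCompact_sub_tail_mem k m
  refine ⟨max T 0, K, hK, fun g hg t ht x hx => ?_⟩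
  have ht0 := (le_max_right _ _).trans ht
  refine ⟨_, hKx (process κ γ F g t 0 x) ((norm_process_le hF hδ hg ht0 x).trans (add_le_add_left hx _)), ?_⟩
  rw [dist_eq_norm, sub_sub_cancel]
  refine lt_of_pow_lt_pow_left₀ 2 hε.le
    ((norm_sq_tail_process_le hF hδ hg hε'.le (hk₁ g hg) hr ht0 hx).trans_lt ?_)
  have h1 := hT t ((le_max_left _ _).trans ht)
  have h2 : (2 * ε' * m + 4 * |κ| * (1 / ((k : ℝ) + 1)) * m ^ 2) / (2 * δ) < ε ^ 2 / 2 := by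
    rw [div_lt_iff₀ (by positivity)]
    linarith
  linarith


/-! ### Complete trajectories and attraction -/

/-- Invariance allows preimages under `S 1` to be chosen inside `A` forever. With `Y n` as the state
at time `-n`, the state at time `t` is reached from any `Y k` with `t + k ≥ 0`, independently of
`k`. -/
theorem IsGlobalAttractor.exists_trajectory {X : Type*} [MetricSpace X] {S : ℝ → X → X}
    {A : Set X} (hA : IsGlobalAttractor S A) (hS0 : ∀ p, S 0 p = p)
    (hS : ∀ s t, 0 ≤ s → 0 ≤ t → ∀ p, S (s + t) p = S s (S t p)) {y : X} (hy : y ∈ A) :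
    ∃ Ψ : ℝ → X, Ψ 0 = y ∧ (∀ t, Ψ t ∈ A) ∧ ∀ s t, 0 ≤ t → Ψ (t + s) = S t (Ψ s) := by
  have hpre : ∀ p : A, ∃ q : A, S 1 q = p := fun p => by
    have hp : (p : X) ∈ S 1 '' A := by
      rw [hA.2.1 1 zero_le_one]
      exact p.2
    obtain ⟨q, hq, hqp⟩ := hp
    exact ⟨⟨q, hq⟩, hqp⟩
  choose pre hpre using hpre
  set Y : ℕ → A := fun n => pre^[n] ⟨y, hy⟩
  have hstep : ∀ n, S 1 (Y (n + 1)) = Y n := fun n => by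
    simp only [Y, Function.iterate_succ_apply', hpre]
  have hY : ∀ k j : ℕ, S j (Y (k + j)) = Y k := fun k j => by
    induction j with
    | zero => simpa using hS0 (Y k)
    | succ j ih =>
      rw [Nat.cast_succ, hS j 1 (Nat.cast_nonneg j) zero_le_one, ← add_assoc, hstep, ih]
  have hcons : ∀ (k j : ℕ) (t : ℝ), 0 ≤ t + k → S (t + (k + j : ℕ)) (Y (k + j)) = S (t + k) (Y k) :=
    fun k j t ht => by
      rw [Nat.cast_add, ← add_assoc, hS _ _ ht (Nat.cast_nonneg j), hY]
  set N : ℝ → ℕ := fun t => ⌈-t⌉₊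
  have hN : ∀ t, 0 ≤ t + N t := fun t => by linarith [Nat.le_ceil (-t)]
  have hΨ : ∀ (k : ℕ) (t : ℝ), 0 ≤ t + k → S (t + N t) (Y (N t)) = S (t + k) (Y k) :=
    fun k t ht => by
      rw [← hcons k (N t) t ht, ← hcons (N t) k t (hN t), add_comm k]
  refine ⟨fun t => S (t + N t) (Y (N t)), ?_, fun t => ?_, fun s t ht => ?_⟩
  · have := hΨ 0 0 (by simp)
    simp only [this]
    simp [hS0, Y]
  · exact (hA.2.1 _ (hN t)).subset (Set.mem_image_of_mem _ (Y (N t)).2)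
  · have := hN s
    beta_reduce
    rw [hΨ (N s) (t + s) (by linarith), add_assoc, hS t _ ht this]

theorem infEDist_fst_le {X Y : Type*} [PseudoEMetricSpace X] [PseudoEMetricSpace Y]
    (p : X × Y) (A : Set (X × Y)) :
    Metric.infEDist p.1 (Prod.fst '' A) ≤ Metric.infEDist p A :=
  Metric.le_infEDist.2 fun _ hq =>
    (Metric.infEDist_le_edist_of_mem (Set.mem_image_of_mem Prod.fst hq)).trans (le_max_left _ _)

theorem infEDist_le_semidist {X : Type*} [MetricSpace X] {U : Set X} {u : X} (hu : u ∈ U)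
    (A : Set X) : Metric.infEDist u A ≤ semidist U A :=
  le_iSup₂ (f := fun u (_ : u ∈ U) => Metric.infEDist u A) u hu

/-- The distance from `x` to `A` is below a quantity tending to `0`. This serves both minimality and
the inclusion of kernel sections. -/
theorem UniformlyAttracts.mem_of_frequently {X G : Type*} [MetricSpace X]
    {U : G → ℝ → ℝ → X → X} {H : Set G} {A : Set X} (hA : UniformlyAttracts U H A)
    (hAc : IsClosed A) {B : Set X} (hB : Bornology.IsBounded B) {t₀ : ℝ} {x : X}
    (hx : ∀ t, t₀ ≤ t → ∃ g ∈ H, x ∈ U g t t₀ '' B) : x ∈ A := by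
  rw [← hAc.closure_eq, Metric.mem_closure_iff_infEDist_zero]
  refine le_antisymm (ge_of_tendsto (hA t₀ B hB) ?_) zero_le
  filter_upwards [eventually_ge_atTop t₀] with t ht
  obtain ⟨g, hg, hxg⟩ := hx t ht
  exact (infEDist_le_semidist hxg A).trans
    (le_iSup₂ (f := fun g (_ : g ∈ H) => semidist (U g t t₀ '' B) A) g hg)

/-! ### The skew product and its projection -/

theorem skewProduct_zero (hF : PowerLipschitz a b F) (hδ : 0 < γ - ‖g₀.2‖)
    (p : l2 × hull g₀) : skewProduct κ γ F g₀ 0 p = p := by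
  refine Prod.ext (process_self hF (damping_pos_of_mem_hull hδ p.2.2) 0 p.1) (Subtype.ext ?_)
  simp [skewProduct, translate, shift, Prod.ext_iff, BoundedContinuousFunction.ext_iff]

theorem skewProduct_add (hF : PowerLipschitz a b F) (hδ : 0 < γ - ‖g₀.2‖) {s t : ℝ}
    (hs : 0 ≤ s) (ht : 0 ≤ t) (p : l2 × hull g₀) : skewProduct κ γ F g₀ (s + t) p =
      skewProduct κ γ F g₀ s (skewProduct κ γ F g₀ t p) := by
  have hp := damping_pos_of_mem_hull hδ p.2.2
  refine Prod.ext ?_ (Subtype.ext (translate_translate s t p.2).symm)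
  simp only [skewProduct]
  rw [process_translate hF hp hs, zero_add, process_process hF hp ht (by linarith)]

/-- Moving the initial time into the symbol reduces every `t₀` to `0`. -/
theorem process_eq_skewProduct (hF : PowerLipschitz a b F) (hδ : 0 < γ - ‖g₀.2‖)
    (hg : g ∈ hull g₀) {s t : ℝ} (hst : s ≤ t) (x : l2) : process κ γ F g t s x =
      (skewProduct κ γ F g₀ (t - s) (x, ⟨translate s g, translate_mem_hull s hg⟩)).1 := by
  simp only [skewProduct]
  rw [process_translate hF (damping_pos_of_mem_hull hδ hg) (by linarith), zero_add,
    sub_add_cancel]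

theorem continuous_skewProduct (hF : PowerLipschitz a b F) (hδ : 0 < γ - ‖g₀.2‖) {t : ℝ}
    (ht : 0 ≤ t) : Continuous (skewProduct κ γ F g₀ t) :=
  (continuous_process hF hδ ht).prodMk
    (((continuous_translate t).comp (continuous_subtype_val.comp continuous_snd)).subtype_mk _)

theorem exists_mapsTo_skewProduct (hF : PowerLipschitz a b F) (hδ : 0 < γ - ‖g₀.2‖)
    {B : Set (l2 × hull g₀)} (hB : Bornology.IsBounded B) :
    ∃ T, 0 ≤ T ∧ ∀ t, T ≤ t → Set.MapsTo (skewProduct κ γ F g₀ t) B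
      (Metric.closedBall 0 (absorbingRadius γ g₀) ×ˢ Set.univ) := by
  obtain ⟨r, hr⟩ := (hB.image_fst).exists_norm_le
  obtain ⟨T, hT0, hT⟩ := exists_norm_process_le_absorbingRadius (κ := κ) hF hδ r
  refine ⟨T, hT0, fun t ht p hp => ⟨mem_closedBall_zero_iff.2 ?_, trivial⟩⟩
  exact hT p.2 p.2.2 0 t (by rwa [sub_zero]) p.1 (hr _ ⟨p, hp, rfl⟩)

theorem asymptoticallyCompactOn_skewProduct (hF : PowerLipschitz a b F)
    (hδ : 0 < γ - ‖g₀.2‖) (hH : IsCompact (hull g₀)) {r : ℝ} (hr : 0 ≤ r) :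
    AsymptoticallyCompactOn (skewProduct κ γ F g₀) (Metric.closedBall 0 r ×ˢ Set.univ) := by
  intro t p ht hp
  have := isCompact_iff_compactSpace.1 hH
  set x : ℕ → l2 := fun n => (skewProduct κ γ F g₀ (t n) (p n)).1
  have htb : TotallyBounded (Set.range x) := by
    refine totallyBounded_of_forall_exists_isCompact fun ε hε => ?_
    obtain ⟨T, K, hK, hKx⟩ := exists_isCompact_approx_process (κ := κ) hF hδ hH hr hε
    obtain ⟨N, hN⟩ := eventually_atTop.1 (ht.eventually_ge_atTop T)
    -- The tail estimate applies only from index `N` on; the finitely many earlier terms are added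
    -- to the compact set.
    refine ⟨K ∪ x '' Set.Iio N, hK.union ((Set.finite_Iio N).image x).isCompact, ?_⟩
    rintro _ ⟨n, rfl⟩
    rcases lt_or_ge n N with hn | hn
    · exact ⟨x n, Or.inr ⟨n, hn, rfl⟩, by rwa [dist_self]⟩
    · obtain ⟨y, hy, hxy⟩ := hKx (p n).2 (p n).2.2 (t n) (hN n hn) (p n).1
        (mem_closedBall_zero_iff.1 (hp n).1)
      exact ⟨y, Or.inl hy, hxy⟩
  have hc : IsCompact (closure (Set.range x)) := htb.closure.isCompact_of_isClosed isClosed_closure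
  obtain ⟨y, -, φ, hφ, hy⟩ := hc.tendsto_subseq fun n => subset_closure ⟨n, rfl⟩
  obtain ⟨g, χ, hχ, hg⟩ := CompactSpace.tendsto_subseq
    fun n => (skewProduct κ γ F g₀ (t (φ n)) (p (φ n))).2
  exact ⟨(y, g), φ ∘ χ, hφ.comp hχ, (hy.comp hχ.tendsto_atTop).prodMk_nhds hg⟩

theorem exists_isGlobalAttractor_skewProduct (hF : PowerLipschitz a b F)
    (hδ : 0 < γ - ‖g₀.2‖) (hH : IsCompact (hull g₀)) :
    ∃ A, IsGlobalAttractor (skewProduct κ γ F g₀) A :=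
  exists_isGlobalAttractor (fun _ _ hs ht p => skewProduct_add hF hδ hs ht p)
    (fun _ ht => continuous_skewProduct hF hδ ht)
    (fun _ hB => exists_mapsTo_skewProduct hF hδ hB)
    (asymptoticallyCompactOn_skewProduct hF hδ hH (by unfold absorbingRadius; positivity))

section

variable {A : Set (l2 × hull g₀)}

theorem IsGlobalAttractor.uniformlyAttracts_fst (hA : IsGlobalAttractor (skewProduct κ γ F g₀) A)
    (hF : PowerLipschitz a b F) (hδ : 0 < γ - ‖g₀.2‖) (hH : IsCompact (hull g₀)) :
    UniformlyAttracts (process κ γ F) (hull g₀) (Prod.fst '' A) := by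
  intro t₀ B hB
  have := isCompact_iff_compactSpace.1 hH
  have hBb : Bornology.IsBounded (B ×ˢ (Set.univ : Set (hull g₀))) :=
    hB.prod isCompact_univ.isBounded
  have hlim := (hA.2.2 _ hBb).comp (tendsto_atTop_add_const_right atTop (-t₀) tendsto_id)
  refine tendsto_of_tendsto_of_tendsto_of_le_of_le' tendsto_const_nhds hlim
    (Eventually.of_forall fun _ => zero_le) ?_
  filter_upwards [eventually_ge_atTop t₀] with t ht
  refine iSup₂_le fun g hg => iSup₂_le ?_
  rintro _ ⟨x, hx, rfl⟩
  rw [process_eq_skewProduct hF hδ hg ht]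
  exact (infEDist_fst_le _ A).trans (infEDist_le_semidist
    (Set.mem_image_of_mem _ (Set.mk_mem_prod hx (Set.mem_univ _))) A)

theorem IsGlobalAttractor.isUniformAttractor_fst
    (hA : IsGlobalAttractor (skewProduct κ γ F g₀) A)
    (hF : PowerLipschitz a b F) (hδ : 0 < γ - ‖g₀.2‖) (hH : IsCompact (hull g₀)) :
    IsUniformAttractor (process κ γ F) (hull g₀) (Prod.fst '' A) := by
  have hc : IsCompact (Prod.fst '' A) := hA.1.image continuous_fst
  refine ⟨hc.isClosed, hA.uniformlyAttracts_fst hF hδ hH, fun A' hA'c hA' => ?_⟩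
  rintro _ ⟨p, hp, rfl⟩
  refine hA'.mem_of_frequently hA'c hc.isBounded (t₀ := 0) fun t ht => ?_
  rw [← hA.2.1 t ht] at hp
  obtain ⟨q, hq, rfl⟩ := hp
  exact ⟨q.2, q.2.2, q.1, ⟨q, hq, rfl⟩, rfl⟩

theorem IsGlobalAttractor.fst_mem_kernelSection
    (hA : IsGlobalAttractor (skewProduct κ γ F g₀) A)
    (hF : PowerLipschitz a b F) (hδ : 0 < γ - ‖g₀.2‖) {p : l2 × hull g₀} (hp : p ∈ A) :
    p.1 ∈ kernelSection κ γ F p.2 0 := by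
  obtain ⟨Ψ, h0, hΨA, hΨ⟩ := hA.exists_trajectory (skewProduct_zero hF hδ)
    (fun _ _ hs ht q => skewProduct_add hF hδ hs ht q) hp
  have hsymbol : ∀ t, ((Ψ t).2 : Cb × Cb) = translate t p.2 := fun t => by
    rcases le_total 0 t with ht | ht
    · have := hΨ 0 t ht
      rw [add_zero, h0] at this
      rw [this]
      rfl
    · have := hΨ t (-t) (by linarith)
      rw [neg_add_cancel, h0] at this
      rw [this]
      change _ = translate t (translate (-t) (Ψ t).2)
      rw [translate_translate, add_neg_cancel]
      simp [translate, shift, Prod.ext_iff, BoundedContinuousFunction.ext_iff]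
  have hproc : ∀ s t, s ≤ t → process κ γ F p.2 t s (Ψ s).1 = (Ψ t).1 := fun s t hst => by
    have := hΨ s (t - s) (by linarith)
    rw [sub_add_cancel] at this
    rw [process_eq_skewProduct hF hδ p.2.2 hst, this]
    congr 2
    exact Prod.ext rfl (Subtype.ext (hsymbol s).symm)
  -- Near `t` the trajectory coincides with the solution started at time `t - 1`.
  have hcont : Continuous fun t => (Ψ t).1 := continuous_iff_continuousAt.2 fun t => by
    have h1 := (isSolution_process (κ := κ) hF (damping_pos_of_mem_hull hδ p.2.2) (t - 1)
      (Ψ (t - 1)).1).2.1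
    exact (h1.congr fun u hu => (hproc _ u hu).symm).continuousAt (Ici_mem_nhds (by linarith))
  obtain ⟨C, hC⟩ := (hA.1.image continuous_fst).isBounded.exists_norm_le
  refine ⟨BoundedContinuousFunction.ofNormedAddCommGroup _ hcont C
    fun t => hC _ ⟨_, hΨA t, rfl⟩, hproc, ?_⟩
  exact congrArg Prod.fst h0

theorem IsGlobalAttractor.fst_image_eq_iUnion_kernelSection
    (hA : IsGlobalAttractor (skewProduct κ γ F g₀) A)
    (hF : PowerLipschitz a b F) (hδ : 0 < γ - ‖g₀.2‖) (hH : IsCompact (hull g₀)) :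
    Prod.fst '' A = ⋃ g ∈ hull g₀, kernelSection κ γ F g 0 := by
  refine Set.Subset.antisymm ?_ (Set.iUnion₂_subset ?_)
  · rintro _ ⟨p, hp, rfl⟩
    exact Set.mem_iUnion₂.2 ⟨p.2, p.2.2, hA.fst_mem_kernelSection hF hδ hp⟩
  · rintro g hg _ ⟨ψ, hψ, rfl⟩
    refine (hA.uniformlyAttracts_fst hF hδ hH).mem_of_frequently
      (hA.1.image continuous_fst).isClosed ψ.isBounded_range (t₀ := 0) fun t ht => ?_
    -- Started at `ψ (-t)` with the symbol shifted by `-t`, the process reaches `ψ 0` at time `t`,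
    -- and all these starting points lie in the bounded range of `ψ`.
    refine ⟨translate (-t) g, translate_mem_hull _ hg, ψ (-t), ⟨_, rfl⟩, ?_⟩
    rw [process_translate hF (damping_pos_of_mem_hull hδ hg) ht, zero_add, add_neg_cancel]
    exact hψ (-t) 0 (by linarith)

end

end DNLS

/-- The family of processes generated by the damped driven nonlinear Schrödinger lattice with
almost periodic driving is well defined, and it has a compact uniform attractor, which is the
projection of the global attractor of the skew-product semigroup and the union of the kernel
sections at time `0`. -/
theorem theorem1 (κ γ a b : ℝ) (F : ℝ → ℝ) (g₀ : DNLS.Cb × DNLS.Cb)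
    (hF : ContinuousOn F (Set.Ici 0)) (hF0 : F 0 = 0) (ha : 0 < a) (hb : 0 < b)
    (hLip : ∀ x y : ℂ, ‖(F (‖x‖ ^ 2) : ℂ) * x - (F (‖y‖ ^ 2) : ℂ) * y‖
      ≤ a * (‖x‖ ^ b + ‖y‖ ^ b) * ‖x - y‖)
    (hγ : 0 < γ) (hΓ : 0 < γ - 2 * ‖g₀.2‖)
    (hg₁ : DNLS.AlmostPeriodic (g₀.1 : ℝ → DNLS.l2))
    (hg₂ : DNLS.AlmostPeriodic (g₀.2 : ℝ → DNLS.l2)) :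
    -- the processes are well defined
    (∀ g ∈ DNLS.hull g₀, ∀ (t₀ : ℝ) (ψ₀ : DNLS.l2),
      DNLS.IsSolution κ γ F g t₀ ψ₀ (fun t => DNLS.process κ γ F g t t₀ ψ₀) ∧
      ∀ φ : ℝ → DNLS.l2, DNLS.IsSolution κ γ F g t₀ ψ₀ φ →
        ∀ t : ℝ, t₀ ≤ t → φ t = DNLS.process κ γ F g t t₀ ψ₀) ∧
    -- the skew product is a semigroup
    (∀ p, DNLS.skewProduct κ γ F g₀ 0 p = p) ∧
    (∀ s t : ℝ, 0 ≤ s → 0 ≤ t → ∀ p, DNLS.skewProduct κ γ F g₀ (s + t) p =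
      DNLS.skewProduct κ γ F g₀ s (DNLS.skewProduct κ γ F g₀ t p)) ∧
    -- the attractors
    ∃ (𝒜 : Set DNLS.l2) (𝒜S : Set (DNLS.l2 × DNLS.hull g₀)),
      IsCompact 𝒜 ∧
      DNLS.IsUniformAttractor (DNLS.process κ γ F) (DNLS.hull g₀) 𝒜 ∧
      DNLS.IsGlobalAttractor (DNLS.skewProduct κ γ F g₀) 𝒜S ∧
      𝒜 = Prod.fst '' 𝒜S ∧
      𝒜 = ⋃ g ∈ DNLS.hull g₀, DNLS.kernelSection κ γ F g 0 := by
  have hF' : DNLS.PowerLipschitz a b F := ⟨ha, hb, hLip⟩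
  have hδ : 0 < γ - ‖g₀.2‖ := by linarith [norm_nonneg g₀.2]
  have hH := DNLS.isCompact_hull hg₁ hg₂
  obtain ⟨A, hA⟩ := DNLS.exists_isGlobalAttractor_skewProduct (κ := κ) hF' hδ hH
  refine ⟨fun g hg t₀ ψ₀ => ?_, DNLS.skewProduct_zero hF' hδ,
    fun s t hs ht p => DNLS.skewProduct_add hF' hδ hs ht p,
    Prod.fst '' A, A, hA.1.image continuous_fst, hA.isUniformAttractor_fst hF' hδ hH, hA, rfl,
    hA.fst_image_eq_iUnion_kernelSection hF' hδ hH⟩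
  have hg' := DNLS.damping_pos_of_mem_hull hδ hg
  exact ⟨DNLS.isSolution_process hF' hg' t₀ ψ₀, fun φ hφ t ht => hφ.eq_process hF' hg' ht⟩
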